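/- **Theorem 4.1 (Ostrowski's Theorem for $\mathbb{Z}$).** Spaces are point-free: the space $[\mathbb{T}]$ of models of a propositional geometric theory $\mathbb{T}$ is the locale whose frame of opens is generated by the propositional symbols of $\mathbb{T}$ subject to the axioms of $\mathbb{T}$; a subspace is a sublocale, cut out by additional geometric sequents; a product of two such spaces is the space of pairs of models. An *upper real* $x$ is given by an upward closed set of rationals $q$ (those with "$x<q$") that is rounded ($x<q$ implies $x<r$ for some rational $r<q$). Let * $[\mathrm{AV}_{\mathbb{Z}}]$ be the space of absolute values on $\mathbb{Z}$ valued in upper reals, i.e. of maps $|\cdot|$ from $\mathbb{Z}$ to the upper reals in $[0,\infty)$ with $|0|=0$, $|1|=1$, $|xy|=|x||y|$ and $|x+y|\le|x|+|y|$ (symbols $|x|<q$, for $x\in\mathbb{Z}$, $q\in\mathbb{Q}$); * $\mathrm{ISpec}(\mathbb{Z})$ be the space of prime ideals $\mathfrak{p}$ of $\mathbb{Z}$ (symbols $a\in\mathfrak{p}$, for $a\in\mathbb{Z}$), the coZariski spectrum; * $\overleftarrow{[-\infty,1]}$ be the space of upper reals $\lambda$ bounded above by $1$ (symbols $\lambda<q$,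 for $q\in\mathbb{Q}$); * $\mathfrak{P}_{\overleftarrow{\Lambda}}$ be the subspace of $\mathrm{ISpec}(\mathbb{Z})\times\overleftarrow{[-\infty,1]}$ of the pairs $(\mathfrak{p},\lambda)$ such that $\lambda<0\leftrightarrow\exists a\in\mathbb{Z}\setminus\{0\}.\,(a\in\mathfrak{p})$. Then there is an isomorphism of locales $[\mathrm{AV}_{\mathbb{Z}}]\cong\mathfrak{P}_{\overleftarrow{\Lambda}}$. It is given by $$|\cdot|\;\longmapsto\;\bigl(\{n\in\mathbb{Z} : |n|<1\},\ \inf\{\log_p|p| : p \text{ a prime number}\}\bigr),$$ and its inverse by $(\mathfrak{p},\lambda)\mapsto|\cdot|_{\mathfrak{p},\lambda}$, where $|0|_{\mathfrak{p},\lambda}=0$ and, for $n\neq0$, with $N\in\mathbb{N}$ the usual absolute value of $n$ and $\mathrm{ord}_p(n)$ the exponent of $p$ in $n$, $$|n|_{\mathfrak{p},\lambda}=\min\Bigl\{1,\ \inf\bigl\{\bigl(p^{\mathrm{ord}_p(n)}\bigr)^{\lambda} : p \text{ a prime number in } \mathfrak{p}\bigr\}\Bigr\}\cdot\max\bigl\{1,N^{\lambda}\bigr\}.$$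 Here the operations are those of upper reals: an empty infimum is $\infty$; for real $b\ge1$, $b^{\lambda}=\inf\{b^{r} : r\in\mathbb{Q},\ \lambda<r\}$; for real $b>1$, $\log_b x<q$ if and only if $x<b^{q}$. These formulas are understood point-free: they determine the inverse images of the subbasic opens $a\in\mathfrak{p}$, $\lambda<q$ and $|n|<q$. -/

import Mathlib

open CategoryTheory

noncomputable section

namespace PointFree

/-! ### Point-free spaces presented by propositional geometric theories

Spaces are locales.  A locale is given by its frame of opens, a subspace of it is a
`Sublocale`, and a map of locales is a frame homomorphism on opens in the other direction. -/

/-- Propositional geometric formulae over the propositional symbols `G`, up to provable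
equivalence without axioms: the free frame on `G`.  A formula is a disjunction of finite
conjunctions of symbols, represented by the collection of all finite sets of symbols whose
conjunction entails it. -/
abbrev Formula (G : Type) : Type := LowerSet (Finset G)ᵒᵈ

/-- A propositional symbol as a formula. -/
def atom {G : Type} (g : G) : Formula G := LowerSet.Iic (OrderDual.toDual {g})

/-- The truth value of a formula in a frame `A`, given the truth values of the symbols. -/
def interp {G : Type} {A : Type*} [Order.Frame A] (v : G → A) (φ : Formula G) : A :=
  ⨆ s : Finset G, ⨆ _ : OrderDual.toDual s ∈ φ, s.inf v

/-- The subspace of a space `X` cut out by the sequents `a ⊢ b` for `R a b`, where `a` and `b`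
are opens of `X`.  It is the largest sublocale on which each of the sequents holds, see
`le_subspace_iff`. -/
def subspace {X : Type*} [Order.Frame X] (R : X → X → Prop) : Sublocale X where
  carrier := {x | ∀ a b, R a b → b ⇨ x ≤ a ⇨ x}
  sInf_mem' s hs a b h := by
    rw [le_himp_iff, le_sInf_iff]
    intro x hx
    have h1 : b ⇨ sInf s ≤ b ⇨ x := himp_le_himp_left (sInf_le hx)
    exact le_himp_iff.mp (h1.trans (hs hx a b h))
  himp_mem' c x hx a b h := by
    rw [himp_left_comm b, himp_left_comm a]
    exact himp_le_himp_left (hx a b h)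

theorem restrict_le_restrict_iff {X : Type*} [Order.Frame X] (S : Sublocale X) (a b : X) :
    S.restrict a ≤ S.restrict b ↔ ∀ x ∈ S, b ⇨ x ≤ a ⇨ x := by
  constructor
  · intro h x hx
    have h1 : b ⇨ x ∈ S := S.himp_mem hx
    rw [le_himp_comm, ← S.giRestrict.gc.le_iff_le (b := ⟨(b ⇨ x) ⇨ x, S.himp_mem hx⟩)]
    refine h.trans ?_
    rw [S.giRestrict.gc.le_iff_le, le_himp_iff]
    exact inf_himp_le
  · intro h
    rw [S.giRestrict.gc.le_iff_le]
    have h1 := h _ (S.restrict b).2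
    have h2 : b ≤ (S.restrict b : X) := S.giRestrict.gc.le_u_l b
    rw [himp_eq_top_iff.mpr h2, top_le_iff, himp_eq_top_iff] at h1
    exact h1

theorem le_subspace_iff {X : Type*} [Order.Frame X] (R : X → X → Prop) (S : Sublocale X) :
    S ≤ subspace R ↔ ∀ a b, R a b → S.restrict a ≤ S.restrict b := by
  simp only [restrict_le_restrict_iff]
  exact ⟨fun h a b hab x hx => h hx a b hab, fun h x hx a b hab => h a b hab x hx⟩

/-- A propositional geometric theory: symbols, and axioms in the form of sequents between
geometric formulae. -/
structure Theory where
  /-- The propositional symbols. -/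
  Sym : Type
  /-- `Ax φ ψ` says that the sequent `φ ⊢ ψ` is an axiom. -/
  Ax : Formula Sym → Formula Sym → Prop

namespace Theory

/-- The frame of opens of the space of models: formulae modulo provable equivalence. -/
abbrev Opens (T : Theory) : Type := subspace T.Ax

/-- The space `[T]` of models of a theory, as a locale. -/
def space (T : Theory) : Locale.{0} := Locale.of T.Opens

/-- The subbasic open given by a propositional symbol. -/
def basic (T : Theory) (g : T.Sym) : T.Opens := (subspace T.Ax).restrict (atom g)

/-- `v` is a model of `T` with truth values in the frame `A`. -/
def IsModel (T : Theory) {A : Type*} [Order.Frame A] (v : T.Sym → A) : Prop :=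
  ∀ φ ψ, T.Ax φ ψ → interp v φ ≤ interp v ψ

/-- The axioms of the theory of pairs of models of two theories. -/
inductive ProdAx (T₁ T₂ : Theory) : Formula (T₁.Sym ⊕ T₂.Sym) → Formula (T₁.Sym ⊕ T₂.Sym) → Prop
  | left {φ ψ} : T₁.Ax φ ψ →
      ProdAx T₁ T₂ (interp (fun g => atom (Sum.inl g)) φ) (interp (fun g => atom (Sum.inl g)) ψ)
  | right {φ ψ} : T₂.Ax φ ψ →
      ProdAx T₁ T₂ (interp (fun g => atom (Sum.inr g)) φ) (interp (fun g => atom (Sum.inr g)) ψ)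

/-- The theory of pairs of models; its space is the product of the two spaces. -/
def prod (T₁ T₂ : Theory) : Theory where
  Sym := T₁.Sym ⊕ T₂.Sym
  Ax := ProdAx T₁ T₂

end Theory

/-! ### The opens of the space of a theory classify the models of the theory -/

section Classifying

variable {G : Type} {A : Type*} [Order.Frame A]

theorem interp_le_iff (v : G → A) (φ : Formula G) (c : A) :
    interp v φ ≤ c ↔ ∀ s : Finset G, OrderDual.toDual s ∈ φ → s.inf v ≤ c := by
  simp [interp]

/-- Interpretation of formulae as a frame homomorphism. -/
def interpHom (v : G → A) : FrameHom (Formula G) A where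
  toFun := interp v
  map_inf' φ ψ := by
    classical
    apply le_antisymm
    · rw [interp_le_iff]
      intro s hs
      exact le_inf (le_iSup₂_of_le s hs.1 le_rfl) (le_iSup₂_of_le s hs.2 le_rfl)
    · rw [← le_himp_iff, interp_le_iff]
      intro s hs
      rw [le_himp_comm, interp_le_iff]
      intro t ht
      rw [le_himp_iff, ← Finset.inf_union]
      refine le_iSup₂_of_le (t ∪ s) ⟨?_, ?_⟩ le_rfl
      · exact φ.lower (show OrderDual.toDual (t ∪ s) ≤ OrderDual.toDual s from
          Finset.subset_union_right) hs
      · exact ψ.lower (show OrderDual.toDual (t ∪ s) ≤ OrderDual.toDual t from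
          Finset.subset_union_left) ht
  map_top' := top_le_iff.mp (le_iSup₂_of_le ∅ trivial (by simp))
  map_sSup' S := by
    apply eq_of_forall_ge_iff
    intro c
    simp only [interp_le_iff, sSup_le_iff, Set.forall_mem_image, LowerSet.mem_sSup_iff]
    grind

theorem interp_atom (v : G → A) (g : G) : interp v (atom g) = v g := by
  apply le_antisymm
  · rw [interp_le_iff]
    intro s hs
    exact Finset.inf_le (Finset.singleton_subset_iff.mp hs)
  · exact le_iSup₂_of_le {g} (le_refl (OrderDual.toDual ({g} : Finset G))) (by simp)

theorem frameHom_eq_interp (f : FrameHom (Formula G) A) (φ : Formula G) :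
    f φ = interp (fun g => f (atom g)) φ := by
  classical
  have key : ∀ s : Finset G, f (LowerSet.Iic (OrderDual.toDual s)) = s.inf fun g => f (atom g) := by
    intro s
    induction s using Finset.induction_on with
    | empty =>
      rw [Finset.inf_empty, ← map_top f]
      congr 1
      ext t
      simp only [LowerSet.coe_Iic, Set.mem_Iic, LowerSet.coe_top, Set.mem_univ, iff_true]
      exact Finset.empty_subset (OrderDual.ofDual t)
    | insert g s hg ih =>
      rw [Finset.inf_insert, ← ih, ← map_inf]
      congr 1
      ext t
      exact Finset.insert_subset_iff.trans (and_congr Finset.singleton_subset_iff.symm Iff.rfl)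
  have h : φ = ⨆ s : Finset G, ⨆ _ : OrderDual.toDual s ∈ φ, LowerSet.Iic (OrderDual.toDual s) := by
    apply le_antisymm
    · intro t ht
      simp only [LowerSet.coe_iSup, Set.mem_iUnion]
      exact ⟨OrderDual.ofDual t, ht, Set.mem_Iic.mpr le_rfl⟩
    · exact iSup₂_le fun s hs => LowerSet.Iic_le.mpr hs
  conv_lhs => rw [h]
  simp only [map_iSup, key]
  rfl

/-- Universal property of a subspace. -/
theorem existsUnique_comp_restrict {X : Type*} [Order.Frame X] (R : X → X → Prop)
    (h : FrameHom X A) (hR : ∀ a b, R a b → h a ≤ h b) :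
    ∃! f : FrameHom (subspace R) A, ∀ x, f ((subspace R).restrict x) = h x := by
  let S := subspace R
  let u : A → X := fun c => sSup {x | h x ≤ c}
  have gc : GaloisConnection h u := by
    intro x c
    refine ⟨fun hx => le_sSup hx, fun hx => (OrderHomClass.mono h hx).trans ?_⟩
    simp only [u, map_sSup]
    exact sSup_le (by rintro _ ⟨y, hy, rfl⟩; exact hy)
  have hu : ∀ c, u c ∈ S := by
    intro c a b hab
    rw [le_himp_iff, ← gc.le_iff_le, map_inf]
    refine (inf_le_inf_left _ (hR a b hab)).trans ?_
    rw [← map_inf, gc.le_iff_le]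
    exact himp_inf_le
  have hj : ∀ x, h (S.restrict x : X) = h x := by
    intro x
    apply le_antisymm
    · rw [gc.le_iff_le]
      exact (S.giRestrict.gc.le_iff_le (b := ⟨u (h x), hu _⟩)).mpr (gc.le_u_l x)
    · exact OrderHomClass.mono h (S.giRestrict.gc.le_u_l x)
  have hs : ∀ y : S, S.restrict (y : X) = y := fun y => S.giRestrict.l_u_eq y
  refine ⟨{ toFun := fun y => h (y : X), map_inf' := fun a b => map_inf h _ _,
            map_top' := by
              change h ((⊤ : S) : X) = ⊤
              rw [← map_top S.restrict, hj, map_top],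
            map_sSup' := fun s => ?_ }, hj, ?_⟩
  · change h ((sSup s : S) : X) = _
    have : sSup s = S.restrict (sSup (Subtype.val '' s)) := by
      rw [map_sSup, Set.image_image]
      simp [hs]
    rw [this, hj, map_sSup, Set.image_image]
  · intro f hf
    ext y
    rw [← hs y, hf]
    exact (hj _).symm

/-- Maps of locales from `A` to the space of a theory are the models of the theory in `A`. -/
theorem Theory.existsUnique_frameHom (T : Theory) (v : T.Sym → A) (hv : T.IsModel v) :
    ∃! f : FrameHom T.Opens A, ∀ g, f (T.basic g) = v g := by
  obtain ⟨f, hf, hu⟩ := existsUnique_comp_restrict T.Ax (interpHom v) hv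
  refine ⟨f, fun g => (hf _).trans (interp_atom v g), fun f' hf' => hu f' fun x => ?_⟩
  have := frameHom_eq_interp (f'.comp (subspace T.Ax).restrict) x
  exact this.trans (congrArg (fun w => interp w x) (funext hf'))

theorem Theory.isModel_comp (T : Theory) (f : FrameHom T.Opens A) :
    T.IsModel fun g => f (T.basic g) := by
  intro φ ψ h
  have := frameHom_eq_interp (f.comp (subspace T.Ax).restrict)
  refine (this φ).symm.le.trans (le_trans ?_ (this ψ).le)
  exact OrderHomClass.mono f ((le_subspace_iff T.Ax _).mp le_rfl φ ψ h)

/-- A model of the product theory is a pair of models. -/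
theorem Theory.isModel_prod_iff (T₁ T₂ : Theory) (v : T₁.Sym ⊕ T₂.Sym → A) :
    (T₁.prod T₂).IsModel v ↔
      T₁.IsModel (fun g => v (Sum.inl g)) ∧ T₂.IsModel (fun g => v (Sum.inr g)) := by
  have hl : ∀ φ, interp v (interp (fun g : T₁.Sym => atom (Sum.inl g : T₁.Sym ⊕ T₂.Sym)) φ) =
      interp (fun g => v (Sum.inl g)) φ := fun φ => by
    have := frameHom_eq_interp ((interpHom v).comp
      (interpHom (fun g : T₁.Sym => atom (Sum.inl g : T₁.Sym ⊕ T₂.Sym)))) φ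
    refine this.trans (congrArg (fun w => interp w φ) (funext fun g => ?_))
    change interp v (interp _ (atom g)) = _
    rw [interp_atom, interp_atom]
  have hr : ∀ φ, interp v (interp (fun g : T₂.Sym => atom (Sum.inr g : T₁.Sym ⊕ T₂.Sym)) φ) =
      interp (fun g => v (Sum.inr g)) φ := fun φ => by
    have := frameHom_eq_interp ((interpHom v).comp
      (interpHom (fun g : T₂.Sym => atom (Sum.inr g : T₁.Sym ⊕ T₂.Sym)))) φ
    refine this.trans (congrArg (fun w => interp w φ) (funext fun g => ?_))
    change interp v (interp _ (atom g)) = _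
    rw [interp_atom, interp_atom]
  constructor
  · intro h
    refine ⟨fun φ ψ hφ => ?_, fun φ ψ hφ => ?_⟩
    · rw [← hl, ← hl]; exact h _ _ (.left hφ)
    · rw [← hr, ← hr]; exact h _ _ (.right hφ)
  · rintro ⟨h₁, h₂⟩ φ ψ h
    cases h with
    | left h => exact (hl _).le.trans ((h₁ _ _ h).trans (hl _).ge)
    | right h => exact (hr _).le.trans ((h₂ _ _ h).trans (hr _).ge)

end Classifying

/-- The inverse image of opens along a map of locales. -/
def preimage {X Y : Locale.{0}} (f : X ⟶ Y) : FrameHom Y X := f.unop.hom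

/-! ### Upper reals -/

/-- A (candidate) upper real `x` with truth values in `A`; the value at the rational `q` is the
truth value of `x < q`.  The laws of upper reals are the sequents `Cut.UpperReal` below. -/
abbrev Cut (A : Type*) : Type _ := ℚ → A

namespace Cut

variable {A : Type*} [Order.Frame A]

/-- The sequents saying that `x` is an upper real in `[-∞, ∞]`, i.e. an upward closed and
rounded set of rationals. -/
inductive UpperReal (x : Cut A) : A → A → Prop
  | up (q r : ℚ) : q ≤ r → UpperReal x (x q) (x r)
  | rounded (q : ℚ) : UpperReal x (x q) (⨆ r : ℚ, ⨆ _ : r < q, x r)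

/-- The sequents saying that `x ≤ y`. -/
inductive Le (x y : Cut A) : A → A → Prop
  | mk (q : ℚ) : Le x y (y q) (x q)

/-- The sequents saying that `x = y`. -/
inductive Eqv (x y : Cut A) : A → A → Prop
  | le {a b : A} : Le x y a b → Eqv x y a b
  | ge {a b : A} : Le y x a b → Eqv x y a b

/-- The sequents saying that `x` is an upper real in `[0, ∞)`. -/
inductive NonnegFinite (x : Cut A) : A → A → Prop
  | real {a b : A} : UpperReal x a b → NonnegFinite x a b
  | nonneg : NonnegFinite x (x 0) ⊥
  | finite : NonnegFinite x ⊤ (⨆ q : ℚ, x q)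

/-- A rational number as an upper real. -/
def const (c : ℚ) : Cut A := fun q => ⨆ _ : c < q, ⊤

/-- Addition. -/
def add (x y : Cut A) : Cut A := fun q =>
  ⨆ s : ℚ, ⨆ t : ℚ, ⨆ _ : s + t = q, x s ⊓ y t

/-- Multiplication of non-negative upper reals. -/
def mul (x y : Cut A) : Cut A := fun q =>
  ⨆ s : ℚ, ⨆ t : ℚ, ⨆ _ : 0 < s ∧ 0 < t ∧ s * t = q, x s ⊓ y t

/-- Binary minimum. -/
def min (x y : Cut A) : Cut A := fun q => x q ⊔ y q

/-- Binary maximum. -/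
def max (x y : Cut A) : Cut A := fun q => x q ⊓ y q

/-- The infimum of the upper reals `x i` over those indices `i` for which `P i` holds. -/
def infOver {ι : Type*} (P : ι → A) (x : ι → Cut A) : Cut A := fun q => ⨆ i, P i ⊓ x i q

/-- The exponential `b ^ x` of an upper real exponent `x < ∞`, for a real base `b ≥ 1`:
the infimum of the `b ^ r` over the rationals `r > x`. -/
def exp (b : ℝ) (x : Cut A) : Cut A := fun q =>
  ⨆ r : ℚ, ⨆ _ : b ^ (r : ℝ) < (q : ℝ), x r

/-- The logarithm, to a base `b > 1`, of a non-negative upper real: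
`log_b x < q` if and only if `x < b ^ q`. -/
def log (b : ℝ) (x : Cut A) : Cut A := fun q =>
  ⨆ r : ℚ, ⨆ _ : (r : ℝ) < b ^ (q : ℝ), x r

end Cut

/-! ### The spaces -/

/-- The sequents saying that `v` is an absolute value (multiplicative seminorm) on `R` with
values in the upper reals in `[0, ∞)`; `v x q` stands for `|x| < q`. -/
inductive AbsoluteValueSeq {R : Type*} [CommRing R] {A : Type*} [Order.Frame A]
    (v : R → Cut A) : A → A → Prop
  | real (x : R) {a b : A} : Cut.NonnegFinite (v x) a b → AbsoluteValueSeq v a b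
  | zero {a b : A} : Cut.Eqv (v 0) (Cut.const 0) a b → AbsoluteValueSeq v a b
  | one {a b : A} : Cut.Eqv (v 1) (Cut.const 1) a b → AbsoluteValueSeq v a b
  | mul (x y : R) {a b : A} :
      Cut.Eqv (v (x * y)) (Cut.mul (v x) (v y)) a b → AbsoluteValueSeq v a b
  | add (x y : R) {a b : A} :
      Cut.Le (v (x + y)) (Cut.add (v x) (v y)) a b → AbsoluteValueSeq v a b

/-- The theory of absolute values on `R`; the symbol `(x, q)` stands for `|x| < q`. -/
def AV (R : Type) [CommRing R] : Theory where
  Sym := R × ℚ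
  Ax := AbsoluteValueSeq (fun x q => atom (x, q))

/-- The generic absolute value: `genericAV R x q` is the open `|x| < q` of `[AV R]`. -/
def genericAV (R : Type) [CommRing R] (x : R) : Cut (AV R).Opens :=
  fun q => (AV R).basic (x, q)

/-- The sequents saying that `P` is a prime ideal of `R`; `P a` stands for `a ∈ 𝔭`. -/
inductive PrimeIdealSeq {R : Type*} [CommRing R] {A : Type*} [Order.Frame A]
    (P : R → A) : A → A → Prop
  | zero : PrimeIdealSeq P ⊤ (P 0)
  | add (a b : R) : PrimeIdealSeq P (P a ⊓ P b) (P (a + b))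
  | mul (a b : R) : PrimeIdealSeq P (P a ⊔ P b) (P (a * b))
  | one : PrimeIdealSeq P (P 1) ⊥
  | prime (a b : R) : PrimeIdealSeq P (P (a * b)) (P a ⊔ P b)

/-- The theory of prime ideals of `R`; its space is the coZariski spectrum. -/
def ISpec (R : Type) [CommRing R] : Theory where
  Sym := R
  Ax := PrimeIdealSeq atom

/-- The sequents saying that `x` is an upper real in `[-∞, 1]`. -/
inductive LeOneSeq {A : Type*} [Order.Frame A] (x : Cut A) : A → A → Prop
  | real {a b : A} : Cut.UpperReal x a b → LeOneSeq x a b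
  | le_one {a b : A} : Cut.Le x (Cut.const 1) a b → LeOneSeq x a b

/-- The theory of upper reals in `[-∞, 1]`; the symbol `q` stands for `λ < q`. -/
def UpperLeOne : Theory where
  Sym := ℚ
  Ax := LeOneSeq atom

/-- The frame of opens of `ISpec(ℤ) × [-∞, 1]`. -/
abbrev PairOpens : Type := ((ISpec ℤ).prod UpperLeOne).Opens

/-- The open `a ∈ 𝔭` of `ISpec(ℤ) × [-∞, 1]`. -/
def pairMem (a : ℤ) : PairOpens := ((ISpec ℤ).prod UpperLeOne).basic (Sum.inl a)

/-- The upper real `λ` on `ISpec(ℤ) × [-∞, 1]`; the value at `q` is the open `λ < q`. -/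
def pairExponent : Cut PairOpens := fun q => ((ISpec ℤ).prod UpperLeOne).basic (Sum.inr q)

/-- The two sequents of the condition `λ < 0 ↔ ∃ a ≠ 0, a ∈ 𝔭`. -/
inductive CompatSeq : PairOpens → PairOpens → Prop
  | mp : CompatSeq (pairExponent 0) (⨆ a : ℤ, ⨆ _ : a ≠ 0, pairMem a)
  | mpr : CompatSeq (⨆ a : ℤ, ⨆ _ : a ≠ 0, pairMem a) (pairExponent 0)

/-- The subspace of `ISpec(ℤ) × [-∞, 1]` of the pairs `(𝔭, λ)` with
`λ < 0 ↔ ∃ a ≠ 0, a ∈ 𝔭`. -/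
def compatiblePairs : Sublocale PairOpens := subspace CompatSeq

/-- The locale of that subspace. -/
def PLambda : Locale.{0} := Locale.of compatiblePairs

/-- The open `a ∈ 𝔭` of the space of compatible pairs. -/
def genericMem (a : ℤ) : compatiblePairs := compatiblePairs.restrict (pairMem a)

/-- The generic `λ` on the space of compatible pairs. -/
def genericExponent : Cut compatiblePairs := fun q => compatiblePairs.restrict (pairExponent q)

/-! ### The two constructions of points -/

variable {A : Type*} [Order.Frame A]

/-- The ideal `{n | |n| < 1}`. -/
def idealOf (v : ℤ → Cut A) (n : ℤ) : A := v n 1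

/-- The exponent `inf_p log_p |p|`, over all prime numbers `p`. -/
def exponentOf (v : ℤ → Cut A) : Cut A :=
  Cut.infOver (fun _ : Nat.Primes => ⊤) (fun p => Cut.log (p : ℕ) (v (p : ℕ)))

/-- The absolute value determined by a pair `(P, l)`: it is `0` at `0`, and for `n ≠ 0`, with
`N` the usual absolute value of `n`, it is
`min {1, inf {(p ^ ord_p n) ^ l | p prime in P}} * max {1, N ^ l}`. -/
def absOf (P : ℤ → A) (l : Cut A) (n : ℤ) : Cut A :=
  if n = 0 then Cut.const 0
  else
    Cut.mul
      (Cut.min (Cut.const 1)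
        (Cut.infOver (fun p : Nat.Primes => P (p : ℕ))
          (fun p => Cut.exp (((p : ℕ) ^ padicValInt p n : ℕ) : ℝ) l)))
      (Cut.max (Cut.const 1) (Cut.exp (n.natAbs : ℝ) l))

end PointFree

end

/-! Both spaces are presented by theories with countably many symbols and countably many conclusions
of axioms. By a Rasiowa–Sikorski argument, classically such locales have enough points
(`AV_le_of_forall_point`, `compatiblePairs_le_of_forall_point`), so an inequality of opens may be
tested at homomorphisms to `Prop`. The two constructions use only joins and finite meets, hence
commute with frame homomorphisms (`map_exponentOf`, `map_absOf`). It therefore suffices to prove the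
correspondence at points.

At a point, an upper real in [0, ∞) is a real number, and an absolute value is a multiplicative
seminorm on ℤ. Ostrowski's theorem (`IsRealAbs.eq_archAbs_or_eq_padicAbs`) leaves two families:
|n|^t with 0 ≤ t ≤ 1, and p-adic ones with value c at p, 0 ≤ c < 1. Compatible pairs split the same
way (`IsCompatiblePair.cases`): the zero ideal with λ = t, or pℤ with p^λ = c. Here c = 0 encodes λ
= -∞ and gives the seminorm with kernel pℤ. The constructions match the two families
(`IsAbsoluteValue.pair_of_point`, `IsCompatiblePair.abs_of_point`).

Back in the frames, each generic model is carried to a model of the other theory. The universal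
properties turn these models into frame homomorphisms, which are mutually inverse because they are
so on generators. -/

namespace PointFree

/-! ### Countably presented frames have enough points -/

section Spatial

variable {A : Type*} [Order.Frame A]

/-- A form of the Rasiowa–Sikorski lemma: countably many joins can be respected by a filter which
contains `a` and does not contain `b`. -/
theorem exists_filter_respecting (S : ℕ → Set A) {a b : A} (hab : ¬ a ≤ b) :
    ∃ F : Order.PFilter A, a ∈ F ∧ b ∉ F ∧ ∀ n, sSup (S n) ∈ F → ∃ s ∈ S n, s ∈ F := by
  have step : ∀ n (x : {x : A // ¬ x ≤ b}), ∃ y : {x : A // ¬ x ≤ b}, (y : A) ≤ x ∧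
      (¬ (x : A) ⊓ sSup (S n) ≤ b → ∃ s ∈ S n, (y : A) ≤ s) := by
    intro n x
    -- The filter will be generated by a descending chain of elements not below `b`. At stage n
    -- either the join is incompatible with staying off `b`, and nothing is done, or the chain is
    -- refined below a member of `S n`.
    by_cases h : (x : A) ⊓ sSup (S n) ≤ b
    · exact ⟨x, le_rfl, fun h' => absurd h h'⟩
    · have : ∃ s ∈ S n, ¬ (x : A) ⊓ s ≤ b := by
        by_contra! h'
        rw [inf_sSup_eq] at h
        exact h (iSup₂_le h')
      obtain ⟨s, hs, hxs⟩ := this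
      exact ⟨⟨x ⊓ s, hxs⟩, inf_le_left, fun _ => ⟨s, hs, inf_le_right⟩⟩
  choose next hle hnext using step
  let x : ℕ → {x : A // ¬ x ≤ b} := fun n => Nat.rec ⟨a, hab⟩ (fun n y => next n y) n
  have hx : Antitone fun n : ℕ => (x n).1 := by
    refine antitone_nat_of_succ_le fun n => ?_
    exact hle n (x n)
  have hF : Order.IsPFilter {y : A | ∃ n, (x n).1 ≤ y} := by
    refine Order.IsPFilter.of_def ⟨a, 0, le_rfl⟩ ?_ ?_
    · rintro y ⟨m, hm⟩ z ⟨n, hn⟩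
      exact ⟨(x (max m n)).1, ⟨_, le_rfl⟩, (hx (le_max_left m n)).trans hm,
        (hx (le_max_right m n)).trans hn⟩
    · rintro y z hyz ⟨n, hn⟩
      exact ⟨n, hn.trans hyz⟩
  refine ⟨hF.toPFilter, ⟨0, le_rfl⟩, fun ⟨n, hn⟩ => (x n).2 hn, ?_⟩
  rintro n ⟨m, hm⟩
  -- Once the join is in the filter, a later term of the chain lies below both `x n` and the join,
  -- so stage n did refine.
  have : ¬ (x n).1 ⊓ sSup (S n) ≤ b := fun h =>
    (x (max m n)).2 ((le_inf (hx (le_max_right m n)) ((hx (le_max_left m n)).trans hm)).trans h)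
  obtain ⟨s, hs, h⟩ := hnext n (x n) this
  exact ⟨s, hs, n + 1, h⟩

/-- A frame has enough points if it is generated by elements `v g`, and there are countably many
formulae `ψ ∈ K` such that truth values of the `v g` extend to a point as soon as they respect all
valid sequents `φ ⊢ ψ` with `ψ ∈ K`. -/
theorem le_of_forall_point {G : Type} (v : G → A) (hgen : ∀ a, ∃ φ, interp v φ = a)
    {K : Set (Formula G)} (hK : K.Countable)
    (hpt : ∀ u : G → Prop, (∀ φ, ∀ ψ ∈ K, interp v φ ≤ interp v ψ → interp u φ ≤ interp u ψ) →
      ∃ p : FrameHom A Prop, ∀ g, p (v g) = u g)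
    {a b : A} (h : ∀ p : FrameHom A Prop, p a → p b) : a ≤ b := by
  by_contra hab
  obtain ⟨α, rfl⟩ := hgen a
  obtain ⟨β, rfl⟩ := hgen b
  -- The join defining `α` is resolved in advance by fixing one disjunct `s₀` not below `b`; `α` and
  -- `β` thus need not belong to `K`.
  rw [interp_le_iff] at hab
  push Not at hab
  obtain ⟨s₀, hs₀, hab⟩ := hab
  -- Adding `⊥` only makes the set nonempty, so that ℕ can enumerate it.
  obtain ⟨k, hk⟩ := (hK.insert ⊥).exists_eq_range (Set.insert_nonempty _ _)
  obtain ⟨F, haF, hbF, hF⟩ := exists_filter_respecting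
    (fun n => {x | ∃ s, OrderDual.toDual s ∈ k n ∧ s.inf v = x}) hab
  have hsup : ∀ φ : Formula G, sSup {x | ∃ s, OrderDual.toDual s ∈ φ ∧ s.inf v = x} =
      interp v φ := fun φ => le_antisymm
    (sSup_le (by rintro _ ⟨s, hs, rfl⟩; exact le_iSup₂_of_le s hs le_rfl))
    ((interp_le_iff _ _ _).2 fun s hs => le_sSup ⟨s, hs, rfl⟩)
  have hfin : ∀ s : Finset G, (s.inf fun g => (v g ∈ F : Prop)) ↔ s.inf v ∈ F := by
    classical
    intro s
    induction s using Finset.induction_on with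
    | empty => simp [Order.PFilter.top_mem]
    | insert g s hg ih => simp [Finset.inf_insert, Order.PFilter.inf_mem_iff, ← ih]
  have hint : ∀ φ : Formula G, interp (fun g => (v g ∈ F : Prop)) φ ↔
      ∃ s, OrderDual.toDual s ∈ φ ∧ s.inf v ∈ F := by
    intro φ
    simp only [interp, iSup_Prop_eq, hfin, exists_prop]
  have hmem : ∀ φ : Formula G, interp (fun g => (v g ∈ F : Prop)) φ → interp v φ ∈ F := by
    intro φ hφ
    obtain ⟨s, hs, h⟩ := (hint φ).1 hφ
    exact Order.PFilter.mem_of_le (le_iSup₂_of_le s hs le_rfl) h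
  obtain ⟨p, hp⟩ := hpt (fun g => v g ∈ F) fun φ ψ hψ hle hφ => by
    obtain ⟨n, rfl⟩ : ψ ∈ Set.range k := hk ▸ Set.mem_insert_of_mem _ hψ
    obtain ⟨_, ⟨s, hs, rfl⟩, h⟩ := hF n (by
      rw [hsup]; exact Order.PFilter.mem_of_le hle (hmem φ hφ))
    exact (hint _).2 ⟨s, hs, h⟩
  have hpv : ∀ φ, p (interp v φ) = interp (fun g => (v g ∈ F : Prop)) φ := fun φ => by
    have := frameHom_eq_interp (p.comp (interpHom v)) φ
    refine this.trans (congrArg (fun w => interp w φ) (funext fun g => ?_))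
    change p (interp v (atom g)) = _
    rw [interp_atom, hp]
  have := h p
  rw [hpv, hpv] at this
  exact hbF (hmem β (this ((hint α).2 ⟨s₀, hs₀, haF⟩)))

theorem Theory.exists_interp_basic (T : Theory) (a : T.Opens) :
    ∃ φ, interp T.basic φ = a :=
  ⟨a, (frameHom_eq_interp (subspace T.Ax).restrict a).symm.trans ((subspace T.Ax).giRestrict.l_u_eq a)⟩

/-- The space of a theory has enough points, if the axioms have countably many conclusions. -/
theorem Theory.le_of_forall_point (T : Theory) (hT : {ψ | ∃ φ, T.Ax φ ψ}.Countable) {a b : T.Opens}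
    (h : ∀ p : FrameHom T.Opens Prop, p a → p b) : a ≤ b := by
  refine PointFree.le_of_forall_point T.basic T.exists_interp_basic hT (fun u hu => ?_) h
  refine (T.existsUnique_frameHom u fun φ ψ hφ => hu φ ψ ⟨φ, hφ⟩ ?_).exists
  exact T.isModel_comp (FrameHom.id _) φ ψ hφ

/-- A subspace of the space of a theory has enough points, if the theory and the sequents cutting
out the subspace have countably many conclusions. -/
theorem Theory.subspace_le_of_forall_point (T : Theory) (hT : {ψ | ∃ φ, T.Ax φ ψ}.Countable)
    (R : T.Opens → T.Opens → Prop) (hR : {b | ∃ a, R a b}.Countable) {a b : subspace R}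
    (h : ∀ p : FrameHom (subspace R) Prop, p a → p b) : a ≤ b := by
  -- The extra sequents relate opens; choosing formulae for these opens turns their conclusions into
  -- countably many formulae in the symbols of `T`.
  choose form hform using T.exists_interp_basic
  have hv : ∀ φ, interp (fun g => (subspace R).restrict (T.basic g)) φ =
      (subspace R).restrict (interp T.basic φ) := fun φ => by
    have := frameHom_eq_interp ((subspace R).restrict.comp (interpHom T.basic)) φ
    refine (this.trans (congrArg (fun w => interp w φ) (funext fun g => ?_))).symm
    change (subspace R).restrict (interp T.basic (atom g)) = _
    rw [interp_atom]
  refine PointFree.le_of_forall_point (fun g => (subspace R).restrict (T.basic g)) (fun a => ?_)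
    (hT.union (hR.image form)) (fun u hu => ?_) h
  · exact ⟨form a, by rw [hv, hform]; exact (subspace R).giRestrict.l_u_eq a⟩
  · obtain ⟨p, hp⟩ := (T.existsUnique_frameHom u fun φ ψ hφ => hu φ ψ (.inl ⟨φ, hφ⟩) (by
      rw [hv, hv]
      exact OrderHomClass.mono _ (T.isModel_comp (FrameHom.id _) φ ψ hφ))).exists
    have hpv : ∀ φ, p (interp T.basic φ) = interp u φ := fun φ => by
      have := frameHom_eq_interp (p.comp (interpHom T.basic)) φ
      refine this.trans (congrArg (fun w => interp w φ) (funext fun g => ?_))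
      change p (interp T.basic (atom g)) = _
      rw [interp_atom, hp]
    obtain ⟨q, hq⟩ := (existsUnique_comp_restrict R p fun a b hab => by
      have := hu (form a) (form b) (.inr ⟨b, ⟨a, hab⟩, rfl⟩) (by
        rw [hv, hv, hform, hform]
        exact (le_subspace_iff R _).1 le_rfl a b hab)
      rwa [← hpv, ← hpv, hform, hform] at this).exists
    exact ⟨q, fun g => (hq _).trans (hp g)⟩

end Spatial

/-! ### Naturality of the constructions on upper reals -/

section Natural

variable {A B : Type*} [Order.Frame A] [Order.Frame B] (f : FrameHom A B)

namespace Cut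

theorem map_const (c q : ℚ) : f (const c q) = const c q := by
  simp only [const, map_iSup, map_top]

theorem map_add (x y : Cut A) (q : ℚ) :
    f (add x y q) = add (fun q => f (x q)) (fun q => f (y q)) q := by
  simp only [add, map_iSup, map_inf]

theorem map_mul (x y : Cut A) (q : ℚ) :
    f (mul x y q) = mul (fun q => f (x q)) (fun q => f (y q)) q := by
  simp only [mul, map_iSup, map_inf]

theorem map_min (x y : Cut A) (q : ℚ) :
    f (min x y q) = min (fun q => f (x q)) (fun q => f (y q)) q := by
  simp only [min, map_sup]

theorem map_max (x y : Cut A) (q : ℚ) :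
    f (max x y q) = max (fun q => f (x q)) (fun q => f (y q)) q := by
  simp only [max, map_inf]

theorem map_infOver {ι : Type*} (P : ι → A) (x : ι → Cut A) (q : ℚ) :
    f (infOver P x q) = infOver (fun i => f (P i)) (fun i q => f (x i q)) q := by
  simp only [infOver, map_iSup, map_inf]

theorem map_exp (b : ℝ) (x : Cut A) (q : ℚ) : f (exp b x q) = exp b (fun q => f (x q)) q := by
  simp only [exp, map_iSup]

theorem map_log (b : ℝ) (x : Cut A) (q : ℚ) : f (log b x q) = log b (fun q => f (x q)) q := by
  simp only [log, map_iSup]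

/-- The sequents are built from joins and finite meets, so those about an image are exactly the
images of the sequents. This form serves both to interpret axioms in a frame and to test sequents at
points; the later lemmas of this kind play the same role. -/
theorem upperReal_map (x : Cut A) :
    UpperReal (fun q => f (x q)) = Relation.Map (UpperReal x) f f := by
  ext a b
  constructor
  · rintro (⟨q, r, h⟩ | ⟨q⟩)
    · exact ⟨_, _, .up q r h, rfl, rfl⟩
    · exact ⟨_, _, .rounded q, rfl, by simp only [map_iSup]⟩
  · rintro ⟨_, _, ⟨q, r, h⟩ | ⟨q⟩, rfl, rfl⟩
    · exact .up q r h
    · simp only [map_iSup]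
      exact .rounded (x := fun q => f (x q)) q

theorem le_map (x y : Cut A) :
    Le (fun q => f (x q)) (fun q => f (y q)) = Relation.Map (Le x y) f f := by
  ext a b
  constructor
  · rintro ⟨q⟩
    exact ⟨_, _, .mk q, rfl, rfl⟩
  · rintro ⟨_, _, ⟨q⟩, rfl, rfl⟩
    exact .mk (x := fun q => f (x q)) (y := fun q => f (y q)) q

theorem eqv_map (x y : Cut A) :
    Eqv (fun q => f (x q)) (fun q => f (y q)) = Relation.Map (Eqv x y) f f := by
  ext a b
  constructor
  · rintro (h | h) <;> rw [le_map] at h <;> obtain ⟨a, b, h, rfl, rfl⟩ := h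
    · exact ⟨_, _, .le h, rfl, rfl⟩
    · exact ⟨_, _, .ge h, rfl, rfl⟩
  · rintro ⟨a, b, h | h, rfl, rfl⟩
    · exact .le (by rw [le_map]; exact ⟨a, b, h, rfl, rfl⟩)
    · exact .ge (by rw [le_map]; exact ⟨a, b, h, rfl, rfl⟩)

theorem nonnegFinite_map (x : Cut A) :
    NonnegFinite (fun q => f (x q)) = Relation.Map (NonnegFinite x) f f := by
  ext a b
  constructor
  · rintro (h | _ | _)
    · rw [upperReal_map] at h
      obtain ⟨a, b, h, rfl, rfl⟩ := h
      exact ⟨a, b, .real h, rfl, rfl⟩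
    · exact ⟨_, _, .nonneg, rfl, map_bot f⟩
    · exact ⟨_, _, .finite, map_top f, by simp only [map_iSup]⟩
  · rintro ⟨a, b, h | _ | _, rfl, rfl⟩
    · exact .real (by rw [upperReal_map]; exact ⟨a, b, h, rfl, rfl⟩)
    · rw [map_bot]
      exact .nonneg (x := fun q => f (x q))
    · rw [map_top, map_iSup]
      exact .finite (x := fun q => f (x q))

end Cut

theorem absoluteValueSeq_map {R : Type*} [CommRing R] (v : R → Cut A) :
    AbsoluteValueSeq (fun x q => f (v x q)) = Relation.Map (AbsoluteValueSeq v) f f := by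
  have h0 : ∀ c : ℚ, (Cut.const c : Cut B) = fun q => f (Cut.const c q) := fun c =>
    funext fun q => (Cut.map_const f c q).symm
  have hm : ∀ x y : R, (Cut.mul (fun q => f (v x q)) (fun q => f (v y q))) =
      fun q => f (Cut.mul (v x) (v y) q) := fun x y => funext fun q => (Cut.map_mul f _ _ q).symm
  have ha : ∀ x y : R, (Cut.add (fun q => f (v x q)) (fun q => f (v y q))) =
      fun q => f (Cut.add (v x) (v y) q) := fun x y => funext fun q => (Cut.map_add f _ _ q).symm
  ext a b
  constructor
  · rintro (⟨x, h⟩ | h | h | ⟨x, y, h⟩ | ⟨x, y, h⟩)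
    · rw [Cut.nonnegFinite_map] at h
      obtain ⟨a, b, h, rfl, rfl⟩ := h
      exact ⟨a, b, .real x h, rfl, rfl⟩
    · rw [h0, Cut.eqv_map] at h
      obtain ⟨a, b, h, rfl, rfl⟩ := h
      exact ⟨a, b, .zero h, rfl, rfl⟩
    · rw [h0, Cut.eqv_map] at h
      obtain ⟨a, b, h, rfl, rfl⟩ := h
      exact ⟨a, b, .one h, rfl, rfl⟩
    · rw [hm, Cut.eqv_map] at h
      obtain ⟨a, b, h, rfl, rfl⟩ := h
      exact ⟨a, b, .mul x y h, rfl, rfl⟩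
    · rw [ha, Cut.le_map] at h
      obtain ⟨a, b, h, rfl, rfl⟩ := h
      exact ⟨a, b, .add x y h, rfl, rfl⟩
  · rintro ⟨a, b, ⟨x, h⟩ | h | h | ⟨x, y, h⟩ | ⟨x, y, h⟩, rfl, rfl⟩
    · exact .real x (by rw [Cut.nonnegFinite_map]; exact ⟨a, b, h, rfl, rfl⟩)
    · exact .zero (by rw [h0, Cut.eqv_map]; exact ⟨a, b, h, rfl, rfl⟩)
    · exact .one (by rw [h0, Cut.eqv_map]; exact ⟨a, b, h, rfl, rfl⟩)
    · exact .mul x y (by rw [hm, Cut.eqv_map]; exact ⟨a, b, h, rfl, rfl⟩)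
    · exact .add x y (by rw [ha, Cut.le_map]; exact ⟨a, b, h, rfl, rfl⟩)

theorem primeIdealSeq_map {R : Type*} [CommRing R] (P : R → A) :
    PrimeIdealSeq (fun a => f (P a)) = Relation.Map (PrimeIdealSeq P) f f := by
  ext a b
  constructor
  · rintro (_ | ⟨a, b⟩ | ⟨a, b⟩ | _ | ⟨a, b⟩)
    · exact ⟨_, _, .zero, map_top f, rfl⟩
    · exact ⟨_, _, .add a b, map_inf f _ _, rfl⟩
    · exact ⟨_, _, .mul a b, map_sup f _ _, rfl⟩
    · exact ⟨_, _, .one, rfl, map_bot f⟩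
    · exact ⟨_, _, .prime a b, rfl, map_sup f _ _⟩
  · rintro ⟨_, _, _ | ⟨a, b⟩ | ⟨a, b⟩ | _ | ⟨a, b⟩, rfl, rfl⟩
    · rw [map_top]; exact .zero (P := fun a => f (P a))
    · rw [map_inf]; exact .add (P := fun a => f (P a)) a b
    · rw [map_sup]; exact .mul (P := fun a => f (P a)) a b
    · rw [map_bot]; exact .one (P := fun a => f (P a))
    · rw [map_sup]; exact .prime (P := fun a => f (P a)) a b

theorem leOneSeq_map (x : Cut A) :
    LeOneSeq (fun q => f (x q)) = Relation.Map (LeOneSeq x) f f := by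
  have h0 : (Cut.const 1 : Cut B) = fun q => f (Cut.const 1 q) :=
    funext fun q => (Cut.map_const f 1 q).symm
  ext a b
  constructor
  · rintro (h | h)
    · rw [Cut.upperReal_map] at h
      obtain ⟨a, b, h, rfl, rfl⟩ := h
      exact ⟨a, b, .real h, rfl, rfl⟩
    · rw [h0, Cut.le_map] at h
      obtain ⟨a, b, h, rfl, rfl⟩ := h
      exact ⟨a, b, .le_one h, rfl, rfl⟩
  · rintro ⟨a, b, h | h, rfl, rfl⟩
    · exact .real (by rw [Cut.upperReal_map]; exact ⟨a, b, h, rfl, rfl⟩)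
    · exact .le_one (by rw [h0, Cut.le_map]; exact ⟨a, b, h, rfl, rfl⟩)

theorem map_exponentOf (v : ℤ → Cut A) (q : ℚ) :
    f (exponentOf v q) = exponentOf (fun n q => f (v n q)) q := by
  simp only [exponentOf, Cut.map_infOver, Cut.map_log, map_top]

theorem map_absOf (P : ℤ → A) (l : Cut A) (n : ℤ) (q : ℚ) :
    f (absOf P l n q) = absOf (fun a => f (P a)) (fun q => f (l q)) n q := by
  unfold absOf
  split_ifs
  · exact Cut.map_const f 0 q
  · simp only [Cut.map_mul, Cut.map_min, Cut.map_max, Cut.map_const, Cut.map_infOver, Cut.map_exp]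

end Natural

/-! ### Models of the theories in a frame -/

section Models

variable {A : Type*} [Order.Frame A]

/-- The axioms are the sequents for the atoms of the free frame, and `interpHom v` carries these
atoms to `v`. -/
theorem isModel_AV_iff {R : Type} [CommRing R] (v : R × ℚ → A) :
    (AV R).IsModel v ↔ ∀ a b, AbsoluteValueSeq (fun x q => v (x, q)) a b → a ≤ b := by
  have h := absoluteValueSeq_map (interpHom v) (fun (x : R) q => atom (x, q))
  have e : (fun (x : R) (q : ℚ) => interpHom v (atom (x, q))) = fun x q => v (x, q) :=
    funext₂ fun x q => interp_atom v _
  rw [← e, h]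
  exact ⟨fun hv a b ⟨φ, ψ, h, ha, hb⟩ => ha ▸ hb ▸ hv φ ψ h, fun hv φ ψ h => hv _ _ ⟨φ, ψ, h, rfl, rfl⟩⟩

theorem isModel_ISpec_iff {R : Type} [CommRing R] (P : R → A) :
    (ISpec R).IsModel P ↔ ∀ a b, PrimeIdealSeq P a b → a ≤ b := by
  have h := primeIdealSeq_map (interpHom P) (atom : R → _)
  have e : (fun x : R => interpHom P (atom x)) = P := funext fun x => interp_atom P _
  rw [e] at h
  rw [h]
  exact ⟨fun hv a b ⟨φ, ψ, h, ha, hb⟩ => ha ▸ hb ▸ hv φ ψ h, fun hv φ ψ h => hv _ _ ⟨φ, ψ, h, rfl, rfl⟩⟩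

theorem isModel_UpperLeOne_iff (l : ℚ → A) :
    UpperLeOne.IsModel l ↔ ∀ a b, LeOneSeq l a b → a ≤ b := by
  have h := leOneSeq_map (interpHom l) (atom : ℚ → _)
  have e : (fun x : ℚ => interpHom l (atom x)) = l := funext fun x => interp_atom l _
  rw [e] at h
  rw [h]
  exact ⟨fun hv a b ⟨φ, ψ, h, ha, hb⟩ => ha ▸ hb ▸ hv φ ψ h, fun hv φ ψ h => hv _ _ ⟨φ, ψ, h, rfl, rfl⟩⟩

/-- `v` is an absolute value with values in upper reals, in the logic of `A`. -/
def IsAbsoluteValue (v : ℤ → Cut A) : Prop := ∀ a b, AbsoluteValueSeq v a b → a ≤ b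

/-- `(P, l)` is a compatible pair of a prime ideal and an exponent, in the logic of `A`. -/
structure IsCompatiblePair (P : ℤ → A) (l : Cut A) : Prop where
  prime : ∀ a b, PrimeIdealSeq P a b → a ≤ b
  exponent : ∀ a b, LeOneSeq l a b → a ≤ b
  compat : l 0 = ⨆ a : ℤ, ⨆ _ : a ≠ 0, P a

theorem existsUnique_frameHom_AV {v : ℤ → Cut A} (hv : IsAbsoluteValue v) :
    ∃! f : FrameHom (AV ℤ).Opens A, ∀ n q, f (genericAV ℤ n q) = v n q := by
  obtain ⟨f, hf, hu⟩ :=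
    (AV ℤ).existsUnique_frameHom (fun g => v g.1 g.2) ((isModel_AV_iff _).2 hv)
  exact ⟨f, fun n q => hf (n, q), fun g hg => hu g fun z => hg z.1 z.2⟩

theorem isAbsoluteValue_comp (f : FrameHom (AV ℤ).Opens A) :
    IsAbsoluteValue fun n q => f (genericAV ℤ n q) :=
  (isModel_AV_iff _).1 ((AV ℤ).isModel_comp f)

theorem existsUnique_frameHom_compatiblePairs {P : ℤ → A} {l : Cut A} (h : IsCompatiblePair P l) :
    ∃! f : FrameHom compatiblePairs A,
      (∀ a, f (genericMem a) = P a) ∧ ∀ q, f (genericExponent q) = l q := by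
  obtain ⟨f, hf, huf⟩ := ((ISpec ℤ).prod UpperLeOne).existsUnique_frameHom (Sum.elim P l)
    ((Theory.isModel_prod_iff _ _ _).2
      ⟨(isModel_ISpec_iff P).2 h.prime, (isModel_UpperLeOne_iff l).2 h.exponent⟩)
  have hP : ∀ a, f (pairMem a) = P a := fun a => hf (.inl a)
  have hl : ∀ q, f (pairExponent q) = l q := fun q => hf (.inr q)
  obtain ⟨g, hg, hug⟩ := existsUnique_comp_restrict CompatSeq f (by
    rintro _ _ (_ | _) <;> simp only [map_iSup, hP, hl, h.compat, le_rfl])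
  refine ⟨g, ⟨fun a => (hg _).trans (hP a), fun q => (hg _).trans (hl q)⟩, fun g' hg' => hug g' ?_⟩
  have := huf (g'.comp compatiblePairs.restrict) (by
    rintro (a | q)
    · exact hg'.1 a
    · exact hg'.2 q)
  exact fun x => DFunLike.congr_fun this x

theorem isCompatiblePair_comp (f : FrameHom compatiblePairs A) :
    IsCompatiblePair (fun a => f (genericMem a)) fun q => f (genericExponent q) := by
  have h := (Theory.isModel_prod_iff _ _ _).1
    (((ISpec ℤ).prod UpperLeOne).isModel_comp (f.comp compatiblePairs.restrict))
  refine ⟨(isModel_ISpec_iff _).1 h.1, (isModel_UpperLeOne_iff _).1 h.2, ?_⟩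
  have hc := (le_subspace_iff CompatSeq _).1 le_rfl
  have : genericExponent 0 = ⨆ a : ℤ, ⨆ _ : a ≠ 0, genericMem a := by
    refine (le_antisymm (hc _ _ .mp) (hc _ _ .mpr)).trans ?_
    simp only [map_iSup]
    rfl
  rw [this]
  simp only [map_iSup]

end Models

/-! ### Both spaces have enough points -/

section Countable

variable {A : Type*} [Order.Frame A]

/-- Only conclusions are counted: a filter is upward closed, so the one obstacle to respecting a
sequent is splitting the disjunction in its conclusion. -/
theorem Cut.countable_upperReal (x : Cut A) : {b | ∃ a, UpperReal x a b}.Countable := by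
  refine ((Set.countable_range x).union
    (Set.countable_range fun q => ⨆ r : ℚ, ⨆ _ : r < q, x r)).mono ?_
  rintro _ ⟨_, ⟨q, r, h⟩ | ⟨q⟩⟩
  · exact .inl ⟨r, rfl⟩
  · exact .inr ⟨q, rfl⟩

theorem Cut.countable_le {A : Type*} (x y : Cut A) : {b | ∃ a, Le x y a b}.Countable := by
  refine (Set.countable_range x).mono ?_
  rintro _ ⟨_, ⟨q⟩⟩
  exact ⟨q, rfl⟩

theorem Cut.countable_eqv {A : Type*} (x y : Cut A) : {b | ∃ a, Eqv x y a b}.Countable := by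
  refine ((countable_le x y).union (countable_le y x)).mono ?_
  rintro b ⟨a, h | h⟩
  · exact .inl ⟨a, h⟩
  · exact .inr ⟨a, h⟩

theorem Cut.countable_nonnegFinite (x : Cut A) : {b | ∃ a, NonnegFinite x a b}.Countable := by
  refine (((countable_upperReal x).insert ⊥).insert (⨆ q, x q)).mono ?_
  rintro b ⟨a, h | _ | _⟩
  · exact .inr (.inr ⟨a, h⟩)
  · exact .inr (.inl rfl)
  · exact .inl rfl

theorem countable_AV (R : Type) [CommRing R] [Countable R] :
    {ψ | ∃ φ, (AV R).Ax φ ψ}.Countable := by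
  let v : R → Cut (Formula (R × ℚ)) := fun x q => atom (x, q)
  refine ((((Set.countable_iUnion fun x => Cut.countable_nonnegFinite (v x)).union
    (Cut.countable_eqv (v 0) (Cut.const 0))).union (Cut.countable_eqv (v 1) (Cut.const 1))).union
    ((Set.countable_iUnion fun z : R × R =>
      Cut.countable_eqv (v (z.1 * z.2)) (Cut.mul (v z.1) (v z.2))).union
    (Set.countable_iUnion fun z : R × R =>
      Cut.countable_le (v (z.1 + z.2)) (Cut.add (v z.1) (v z.2))))).mono ?_
  rintro b ⟨a, ⟨x, h⟩ | h | h | ⟨x, y, h⟩ | ⟨x, y, h⟩⟩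
  · exact .inl (.inl (.inl (Set.mem_iUnion.2 ⟨x, a, h⟩)))
  · exact .inl (.inl (.inr ⟨a, h⟩))
  · exact .inl (.inr ⟨a, h⟩)
  · exact .inr (.inl (Set.mem_iUnion.2 ⟨(x, y), a, h⟩))
  · exact .inr (.inr (Set.mem_iUnion.2 ⟨(x, y), a, h⟩))

theorem countable_ISpec (R : Type) [CommRing R] [Countable R] :
    {ψ | ∃ φ, (ISpec R).Ax φ ψ}.Countable := by
  let P : R → Formula R := atom
  refine (((Set.countable_range P).union
    (Set.countable_range fun z : R × R => P z.1 ⊔ P z.2)).insert ⊥).mono ?_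
  rintro _ ⟨_, _ | ⟨a, b⟩ | ⟨a, b⟩ | _ | ⟨a, b⟩⟩
  · exact .inr (.inl ⟨_, rfl⟩)
  · exact .inr (.inl ⟨_, rfl⟩)
  · exact .inr (.inl ⟨_, rfl⟩)
  · exact .inl rfl
  · exact .inr (.inr ⟨(a, b), rfl⟩)

theorem countable_UpperLeOne : {ψ | ∃ φ, UpperLeOne.Ax φ ψ}.Countable := by
  let x : Cut (Formula ℚ) := atom
  refine ((Cut.countable_upperReal x).union (Cut.countable_le x (Cut.const 1))).mono ?_
  rintro b ⟨a, h | h⟩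
  · exact .inl ⟨a, h⟩
  · exact .inr ⟨a, h⟩

theorem Theory.countable_prod {T₁ T₂ : Theory} (h₁ : {ψ | ∃ φ, T₁.Ax φ ψ}.Countable)
    (h₂ : {ψ | ∃ φ, T₂.Ax φ ψ}.Countable) : {ψ | ∃ φ, (T₁.prod T₂).Ax φ ψ}.Countable := by
  refine ((h₁.image (interp fun g => atom (Sum.inl g))).union
    (h₂.image (interp fun g => atom (Sum.inr g)))).mono ?_
  rintro _ ⟨_, h | h⟩
  · exact .inl ⟨_, ⟨_, h⟩, rfl⟩
  · exact .inr ⟨_, ⟨_, h⟩, rfl⟩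

theorem AV_le_of_forall_point {a b : (AV ℤ).Opens}
    (h : ∀ p : FrameHom (AV ℤ).Opens Prop, p a → p b) : a ≤ b :=
  (AV ℤ).le_of_forall_point (countable_AV ℤ) h

theorem compatiblePairs_le_of_forall_point {a b : compatiblePairs}
    (h : ∀ p : FrameHom compatiblePairs Prop, p a → p b) : a ≤ b := by
  refine Theory.subspace_le_of_forall_point _
    (Theory.countable_prod (countable_ISpec ℤ) countable_UpperLeOne) CompatSeq ?_ h
  refine ((Set.countable_singleton (pairExponent 0)).insert (⨆ a : ℤ, ⨆ _ : a ≠ 0, pairMem a)).mono ?_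
  rintro _ ⟨_, _ | _⟩
  · exact .inl rfl
  · exact .inr rfl

end Countable

/-! ### Upper reals at a point -/

namespace Cut

/-- The classical upper real `u` is the real number `x`. -/
def Represents (u : Cut Prop) (x : ℝ) : Prop := ∀ q : ℚ, u q ↔ x < q

theorem represents_const (c : ℚ) : Represents (const c) c := by
  intro q
  simp [const]

theorem Represents.eq {u v : Cut Prop} {x : ℝ} (hu : Represents u x) (hv : Represents v x) :
    u = v :=
  funext fun q => propext ((hu q).trans (hv q).symm)

theorem Represents.le_iff {u v : Cut Prop} {x y : ℝ} (hu : Represents u x) (hv : Represents v y) :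
    (∀ a b, Le u v a b → a ≤ b) ↔ x ≤ y := by
  constructor
  · intro h
    by_contra! hlt
    obtain ⟨r, h1, h2⟩ := exists_rat_btwn hlt
    exact absurd ((hu r).1 (h _ _ (.mk r) ((hv r).2 h1))) h2.not_gt
  · rintro h _ _ ⟨q⟩ hq
    exact (hu q).2 (h.trans_lt ((hv q).1 hq))

theorem Represents.eqv_iff {u v : Cut Prop} {x y : ℝ} (hu : Represents u x)
    (hv : Represents v y) : (∀ a b, Eqv u v a b → a ≤ b) ↔ x = y := by
  rw [le_antisymm_iff, ← hu.le_iff hv, ← hv.le_iff hu]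
  exact ⟨fun h => ⟨fun a b hab => h a b (.le hab), fun a b hab => h a b (.ge hab)⟩,
    fun h a b hab => hab.casesOn (h.1 a b) (h.2 a b)⟩

theorem Represents.add {u v : Cut Prop} {x y : ℝ} (hu : Represents u x) (hv : Represents v y) :
    Represents (add u v) (x + y) := by
  intro q
  simp only [Cut.add, iSup_Prop_eq, inf_Prop_eq, hu _, hv _, exists_prop]
  constructor
  · rintro ⟨s, t, rfl, hs, ht⟩
    push_cast
    exact add_lt_add hs ht
  · intro h
    obtain ⟨s, h1, h2⟩ := exists_rat_btwn (lt_sub_iff_add_lt.2 h)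
    exact ⟨s, q - s, by ring, h1, by push_cast; linarith⟩

theorem Represents.mul {u v : Cut Prop} {x y : ℝ} (hu : Represents u x) (hv : Represents v y)
    (hx : 0 ≤ x) (hy : 0 ≤ y) : Represents (mul u v) (x * y) := by
  intro q
  simp only [Cut.mul, iSup_Prop_eq, inf_Prop_eq, hu _, hv _, exists_prop]
  constructor
  · rintro ⟨s, t, ⟨-, -, rfl⟩, hs, ht⟩
    push_cast
    exact mul_lt_mul'' hs ht hx hy
  · intro h
    have hq : (0 : ℝ) < q := (mul_nonneg hx hy).trans_lt h
    -- `s` lies between x and q / y; when y = 0 any rational above x works.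
    obtain ⟨s, h1, h2⟩ : ∃ s : ℚ, x < s ∧ s * y < q := by
      rcases hy.eq_or_lt with rfl | hy
      · obtain ⟨s, hs⟩ := exists_rat_gt x
        exact ⟨s, hs, by simpa using hq⟩
      · obtain ⟨s, h1, h2⟩ := exists_rat_btwn ((lt_div_iff₀ hy).2 h)
        exact ⟨s, h1, (lt_div_iff₀ hy).1 h2⟩
    have hs : (0 : ℝ) < s := hx.trans_lt h1
    have hs' : 0 < s := by exact_mod_cast hs
    have hq' : 0 < q := by exact_mod_cast hq
    refine ⟨s, q / s, ⟨hs', div_pos hq' hs', by field_simp⟩, h1, ?_⟩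
    push_cast
    rwa [lt_div_iff₀ hs, mul_comm]

theorem Represents.max {u v : Cut Prop} {x y : ℝ} (hu : Represents u x) (hv : Represents v y) :
    Represents (max u v) (x ⊔ y) := by
  intro q
  simp only [Cut.max, inf_Prop_eq, hu _, hv _, sup_lt_iff]

theorem Represents.exp {u : Cut Prop} {x b : ℝ} (hu : Represents u x) (hb : 1 ≤ b) :
    Represents (exp b u) (b ^ x) := by
  intro q
  simp only [Cut.exp, iSup_Prop_eq, hu _, exists_prop]
  constructor
  · rintro ⟨r, h1, h2⟩
    exact (Real.rpow_le_rpow_of_exponent_le hb h2.le).trans_lt h1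
  · intro h
    have hc : ContinuousAt (fun t : ℝ => b ^ t) x :=
      Real.continuousAt_const_rpow (zero_lt_one.trans_le hb).ne'
    obtain ⟨ε, hε, h'⟩ := Metric.eventually_nhds_iff.1 (hc.eventually_lt_const h)
    obtain ⟨r, h1, h2⟩ := exists_rat_btwn (lt_add_of_pos_right x hε)
    exact ⟨r, h' (by rw [Real.dist_eq, abs_lt]; constructor <;> linarith), h1⟩

theorem Represents.upperReal {u : Cut Prop} {x : ℝ} (hu : Represents u x) :
    ∀ a b, UpperReal u a b → a ≤ b := by
  rintro _ _ (⟨q, r, h⟩ | ⟨q⟩) hq <;> rw [hu] at hq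
  · exact (hu r).2 (hq.trans_le (by exact_mod_cast h))
  · obtain ⟨r, h1, h2⟩ := exists_rat_btwn hq
    simp only [iSup_Prop_eq, exists_prop]
    exact ⟨r, by exact_mod_cast h2, (hu r).2 h1⟩

theorem Represents.nonnegFinite {u : Cut Prop} {x : ℝ} (hu : Represents u x) (hx : 0 ≤ x) :
    ∀ a b, NonnegFinite u a b → a ≤ b := by
  rintro _ _ (h | _ | _)
  · exact hu.upperReal _ _ h
  · intro h
    rw [hu, Rat.cast_zero] at h
    exact absurd h hx.not_gt
  · intro _
    simp only [iSup_Prop_eq, hu _]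
    exact exists_rat_gt x

/-- An upper real is determined by an infimum, in any parametrisation of an interval of reals. -/
theorem iff_sInf_lt {u : Cut Prop} (hu : ∀ a b, UpperReal u a b → a ≤ b) {e : ℚ → ℝ}
    (he : StrictMono e) (hne : ∃ q, u q) (hbdd : BddBelow (e '' {q | u q})) (q : ℚ) :
    u q ↔ sInf (e '' {q | u q}) < e q := by
  constructor
  · intro hq
    have := hu _ _ (.rounded q) hq
    simp only [iSup_Prop_eq, exists_prop] at this
    obtain ⟨r, hr, hur⟩ := this
    exact (csInf_le hbdd ⟨r, hur, rfl⟩).trans_lt (he hr)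
  · intro h
    obtain ⟨q₀, hq₀⟩ := hne
    obtain ⟨_, ⟨r, hr, rfl⟩, hlt⟩ := exists_lt_of_csInf_lt (Set.Nonempty.image e ⟨q₀, hq₀⟩) h
    exact hu _ _ (.up r q (he.lt_iff_lt.1 hlt).le) hr

/-- The real number is the infimum of the cut: finiteness makes the cut nonempty, and non-negativity
bounds it below by 0. -/
theorem exists_represents {u : Cut Prop} (hu : ∀ a b, NonnegFinite u a b → a ≤ b) :
    ∃ x, 0 ≤ x ∧ Represents u x := by
  have h0 : ∀ q ∈ {q | u q}, (0 : ℝ) ≤ q := by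
    intro q hq
    by_contra! h
    exact hu _ _ .nonneg (hu _ _ (.real (.up q 0 (by exact_mod_cast h.le))) hq)
  have hfin := hu _ _ .finite trivial
  simp only [iSup_Prop_eq] at hfin
  refine ⟨_, Real.sInf_nonneg ?_, iff_sInf_lt (fun a b h => hu a b (.real h)) Rat.cast_strictMono
    hfin ⟨0, ?_⟩⟩
  · rintro _ ⟨q, hq, rfl⟩
    exact h0 q hq
  · rintro _ ⟨q, hq, rfl⟩
    exact h0 q hq

end Cut

/-! ### Absolute values on the integers at a point -/

/-- `N` is a real-valued multiplicative seminorm on the integers. -/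
structure IsRealAbs (N : ℤ → ℝ) : Prop where
  nonneg : ∀ n, 0 ≤ N n
  zero : N 0 = 0
  one : N 1 = 1
  mul : ∀ m n, N (m * n) = N m * N n
  add : ∀ m n, N (m + n) ≤ N m + N n

theorem isAbsoluteValue_iff_exists {v : ℤ → Cut Prop} :
    IsAbsoluteValue v ↔ ∃ N, IsRealAbs N ∧ ∀ n, (v n).Represents (N n) := by
  constructor
  · intro hv
    choose N h0 hN using fun n => Cut.exists_represents fun a b h => hv a b (.real n h)
    refine ⟨N, ⟨h0, ?_, ?_, fun m n => ?_, fun m n => ?_⟩, hN⟩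
    · simpa using ((hN 0).eqv_iff (Cut.represents_const 0)).1 fun a b h => hv a b (.zero h)
    · simpa using ((hN 1).eqv_iff (Cut.represents_const 1)).1 fun a b h => hv a b (.one h)
    · exact ((hN _).eqv_iff ((hN m).mul (hN n) (h0 m) (h0 n))).1 fun a b h => hv a b (.mul m n h)
    · exact ((hN _).le_iff ((hN m).add (hN n))).1 fun a b h => hv a b (.add m n h)
  · rintro ⟨N, h, hN⟩ a b (⟨n, hab⟩ | hab | hab | ⟨m, n, hab⟩ | ⟨m, n, hab⟩)
    · exact (hN n).nonnegFinite (h.nonneg n) a b hab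
    · exact ((hN 0).eqv_iff (Cut.represents_const 0)).2 (by simpa using h.zero) a b hab
    · exact ((hN 1).eqv_iff (Cut.represents_const 1)).2 (by simpa using h.one) a b hab
    · exact ((hN _).eqv_iff ((hN m).mul (hN n) (h.nonneg m) (h.nonneg n))).2 (h.mul m n) a b hab
    · exact ((hN _).le_iff ((hN m).add (hN n))).2 (h.add m n) a b hab

namespace IsRealAbs

variable {N : ℤ → ℝ} (h : IsRealAbs N)
include h

theorem neg_one : N (-1) = 1 := by
  have h1 := h.mul (-1) (-1)
  norm_num [h.one] at h1
  rcases mul_self_eq_one_iff.1 h1.symm with h2 | h2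
  · exact h2
  · linarith [h.nonneg (-1)]

theorem natAbs (n : ℤ) : N n.natAbs = N n := by
  rcases n.natAbs_eq with hn | hn
  · rw [← hn]
  · conv_rhs => rw [hn, neg_eq_neg_one_mul, h.mul, h.neg_one, one_mul]

theorem pow (n : ℤ) (k : ℕ) : N (n ^ k) = N n ^ k := by
  induction k with
  | zero => simp [h.one]
  | succ k ih => rw [pow_succ, pow_succ, h.mul, ih]

theorem natCast_le (n : ℕ) : N n ≤ n := by
  induction n with
  | zero => simp [h.zero]
  | succ n ih =>
    push_cast
    exact (h.add _ _).trans (by rw [h.one]; linarith)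

/-- Induction on the number d of base-b digits: splitting off the last digit, whose seminorm is at
most b, leaves b times a number with one digit fewer. -/
theorem natCast_le_of_lt_pow {b : ℕ} (hb : 2 ≤ b) {M : ℝ} (hM : 1 ≤ M) (hbM : N b ≤ M) (d : ℕ) :
    ∀ n : ℕ, n < b ^ d → N n ≤ b * d * M ^ d := by
  induction d with
  | zero =>
    intro n hn
    obtain rfl : n = 0 := by simpa using hn
    simp [h.zero]
  | succ d ih =>
    intro n hn
    have hn' : N (n / b : ℕ) ≤ b * d * M ^ d := ih _ (by
      rw [Nat.div_lt_iff_lt_mul (by omega)]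
      rwa [pow_succ] at hn)
    have hmod : N (n % b : ℕ) ≤ b * M ^ (d + 1) := by
      refine (h.natCast_le _).trans ?_
      have : ((n % b : ℕ) : ℝ) ≤ b := by exact_mod_cast (Nat.mod_lt n (by omega)).le
      exact this.trans (le_mul_of_one_le_right (by positivity) (one_le_pow₀ hM))
    have hsplit : (n : ℤ) = (n % b : ℕ) + (b : ℤ) * (n / b : ℕ) := by
      exact_mod_cast (Nat.mod_add_div n b).symm
    calc N n ≤ N (n % b : ℕ) + N b * N (n / b : ℕ) := by
          rw [← h.mul]; conv_lhs => rw [hsplit]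
          exact h.add _ _
      _ ≤ b * M ^ (d + 1) + M * (b * d * M ^ d) := by
          gcongr
          exact h.nonneg _
      _ = b * (d + 1 : ℕ) * M ^ (d + 1) := by push_cast; ring

theorem natCast_le_rpow_logb {b n : ℕ} (hb : 2 ≤ b) (hn : 1 ≤ n) {M : ℝ} (hM : 1 ≤ M)
    (hbM : N b ≤ M) : N n ≤ M ^ Real.logb b n := by
  have hM0 : 0 < M := by linarith
  have hbR : (1 : ℝ) < b := by exact_mod_cast hb
  set L := Real.logb b n
  have hL : 0 ≤ L := Real.logb_nonneg hbR (by exact_mod_cast hn)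
  -- Power trick: apply the digit bound to n^k, which has at most L k + 1 digits. The unwanted
  -- factor is then only linear in k.
  have key : ∀ k : ℕ, N n ^ k ≤ b * M * (L * k + 1) * (M ^ L) ^ k := by
    intro k
    have h1 := h.natCast_le_of_lt_pow hb hM hbM (Nat.log b (n ^ k) + 1) (n ^ k)
      (Nat.lt_pow_succ_log_self hb _)
    push_cast at h1
    rw [h.pow] at h1
    have h2 : (Nat.log b (n ^ k) : ℝ) ≤ L * k := by
      refine (Real.natLog_le_logb _ _).trans ?_
      push_cast
      rw [Real.logb_pow, mul_comm]
    have h3 : M ^ Nat.log b (n ^ k) ≤ (M ^ L) ^ k := by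
      rw [← Real.rpow_natCast, ← Real.rpow_natCast, ← Real.rpow_mul hM0.le]
      exact Real.rpow_le_rpow_of_exponent_le hM h2
    calc N n ^ k ≤ b * (Nat.log b (n ^ k) + 1) * (M ^ Nat.log b (n ^ k) * M) := by
          rwa [pow_succ] at h1
      _ ≤ b * (L * k + 1) * ((M ^ L) ^ k * M) := by gcongr
      _ = _ := by ring
  by_contra! hlt
  have hy : 0 < M ^ L := Real.rpow_pos_of_pos hM0 L
  set r := N n / M ^ L
  have hr : 1 < r := (one_lt_div hy).2 hlt
  have hk : ∀ k : ℕ, r ^ k ≤ b * M * (L * k + 1) := by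
    intro k
    rw [div_pow, div_le_iff₀ (by positivity)]
    exact key k
  -- Exponential growth of `r ^ k` beats the linear bound: dividing by `r ^ k` gives 1 ≤ a sequence
  -- tending to 0.
  have ht : Filter.Tendsto (fun k : ℕ => b * M * (L * ((k : ℝ) ^ 1 / r ^ k) + (k : ℝ) ^ 0 / r ^ k))
      Filter.atTop (nhds (b * M * (L * 0 + 0))) :=
    (((tendsto_pow_const_div_const_pow_of_one_lt 1 hr).const_mul L).add
      (tendsto_pow_const_div_const_pow_of_one_lt 0 hr)).const_mul _
  have : (1 : ℝ) ≤ b * M * (L * 0 + 0) := ge_of_tendsto' ht fun k => by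
    have hrk : 0 < r ^ k := by positivity
    have := (one_le_div hrk).2 (hk k)
    refine this.trans_eq ?_
    field_simp
  norm_num at this

theorem le_one_of_natCast_le_one {b : ℕ} (hb : 2 ≤ b) (hN : N b ≤ 1) (n : ℤ) : N n ≤ 1 := by
  rw [← h.natAbs]
  rcases Nat.eq_zero_or_pos n.natAbs with h0 | h0
  · simp [h0, h.zero]
  · simpa using h.natCast_le_rpow_logb hb h0 le_rfl hN

/-- Otherwise high powers of p and n would both have seminorm below 1/2. They are coprime, and the
Bézout coefficients have seminorm at most 1, so the triangle inequality would give N 1 < 1. -/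
theorem eq_one_of_not_dvd {p : ℕ} (hp : p.Prime) (hN : N p < 1) {n : ℤ} (hn : ¬ (p : ℤ) ∣ n) :
    N n = 1 := by
  have hle := h.le_one_of_natCast_le_one hp.two_le hN.le
  refine (hle n).antisymm ?_
  by_contra! hlt
  have hpz := Nat.prime_iff_prime_int.1 hp
  have hev : ∀ x : ℝ, 0 ≤ x → x < 1 → ∀ᶠ k : ℕ in Filter.atTop, x ^ k < 1 / 2 := fun x h0 h1 =>
    (tendsto_pow_atTop_nhds_zero_of_lt_one h0 h1).eventually_lt_const (by norm_num)
  obtain ⟨k, h1, h2⟩ := ((hev _ (h.nonneg p) hN).and (hev _ (h.nonneg n) hlt)).exists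
  obtain ⟨a, b, hab⟩ : IsCoprime ((p : ℤ) ^ k) (n ^ k) :=
    ((Prime.coprime_iff_not_dvd hpz).2 hn).pow
  have h3 := h.add (a * p ^ k) (b * n ^ k)
  rw [hab, h.one, h.mul, h.mul, h.pow, h.pow] at h3
  have h4 := mul_le_mul_of_nonneg_right (hle a) (pow_nonneg (h.nonneg p) k)
  have h5 := mul_le_mul_of_nonneg_right (hle b) (pow_nonneg (h.nonneg n) k)
  linarith

end IsRealAbs

/-- The archimedean absolute value `|n| ^ t`, which is trivial for `t = 0`. -/
noncomputable def archAbs (t : ℝ) (n : ℤ) : ℝ := if n = 0 then 0 else (n.natAbs : ℝ) ^ t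

/-- The `p`-adic absolute value with value `c` at `p`; for `c = 0` it has kernel `pℤ`. -/
def padicAbs (p : ℕ) (c : ℝ) (n : ℤ) : ℝ := if n = 0 then 0 else c ^ padicValInt p n

theorem isRealAbs_archAbs {t : ℝ} (h0 : 0 ≤ t) (h1 : t ≤ 1) : IsRealAbs (archAbs t) where
  nonneg n := by unfold archAbs; positivity
  zero := by simp [archAbs]
  one := by simp [archAbs]
  mul m n := by
    rcases eq_or_ne m 0 with rfl | hm
    · simp [archAbs]
    rcases eq_or_ne n 0 with rfl | hn
    · simp [archAbs]
    simp [archAbs, hm, hn, Int.natAbs_mul, Real.mul_rpow]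
  add m n := by
    have hnn : ∀ n, 0 ≤ archAbs t n := fun n => by unfold archAbs; positivity
    rcases eq_or_ne m 0 with rfl | hm
    · simp [archAbs]
    rcases eq_or_ne n 0 with rfl | hn
    · simp [archAbs]
    by_cases hmn : m + n = 0
    · have : archAbs t (m + n) = 0 := by simp [archAbs, hmn]
      rw [this]
      exact add_nonneg (hnn m) (hnn n)
    · simp only [archAbs, hm, hn, hmn, if_false]
      refine le_trans ?_ (Real.rpow_add_le_add_rpow (by positivity) (by positivity) h0 h1)
      refine Real.rpow_le_rpow (by positivity) ?_ h0
      exact_mod_cast Int.natAbs_add_le m n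

theorem isRealAbs_padicAbs {p : ℕ} (hp : p.Prime) {c : ℝ} (h0 : 0 ≤ c) (h1 : c ≤ 1) :
    IsRealAbs (padicAbs p c) where
  nonneg n := by unfold padicAbs; positivity
  zero := by simp [padicAbs]
  one := by simp [padicAbs]
  mul m n := by
    have := Fact.mk hp
    rcases eq_or_ne m 0 with rfl | hm
    · simp [padicAbs]
    rcases eq_or_ne n 0 with rfl | hn
    · simp [padicAbs]
    simp [padicAbs, hm, hn, padicValInt.mul hm hn, pow_add]
  add m n := by
    have := Fact.mk hp
    have hnn : ∀ n, 0 ≤ padicAbs p c n := fun n => by unfold padicAbs; positivity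
    rcases eq_or_ne m 0 with rfl | hm
    · simp [padicAbs]
    rcases eq_or_ne n 0 with rfl | hn
    · simp [padicAbs]
    by_cases hmn : m + n = 0
    · have : padicAbs p c (m + n) = 0 := by simp [padicAbs, hmn]
      rw [this]
      exact add_nonneg (hnn m) (hnn n)
    -- The ultrametric inequality, stronger than the required one.
    · have hv : min (padicValInt p m) (padicValInt p n) ≤ padicValInt p (m + n) := by
        have := (padicValInt_dvd_iff (p := p) (min (padicValInt p m) (padicValInt p n)) (m + n)).1
          (dvd_add ((pow_dvd_pow _ (min_le_left _ _)).trans (padicValInt_dvd m))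
            ((pow_dvd_pow _ (min_le_right _ _)).trans (padicValInt_dvd n)))
        exact this.resolve_left hmn
      have hm' := hnn m
      have hn' := hnn n
      simp only [padicAbs, hm, hn, hmn, if_false] at hm' hn' ⊢
      refine (pow_le_pow_of_le_one h0 h1 hv).trans ?_
      rcases min_choice (padicValInt p m) (padicValInt p n) with h | h <;> rw [h] <;> linarith

/-- Ostrowski's theorem for multiplicative seminorms on the integers. -/
theorem IsRealAbs.eq_archAbs_or_eq_padicAbs {N : ℤ → ℝ} (h : IsRealAbs N) :
    (∃ t, 0 ≤ t ∧ t ≤ 1 ∧ N = archAbs t) ∨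
      ∃ p : ℕ, p.Prime ∧ ∃ c, 0 ≤ c ∧ c < 1 ∧ N = padicAbs p c := by
  by_cases hex : ∃ p : ℕ, p.Prime ∧ N p < 1
  · right
    obtain ⟨p, hp, hlt⟩ := hex
    refine ⟨p, hp, N p, h.nonneg p, hlt, funext fun n => ?_⟩
    unfold padicAbs
    split_ifs with hn
    · rw [hn, h.zero]
    · have := Fact.mk hp
      -- Write n as a power of p times a cofactor prime to p, which has seminorm 1.
      obtain ⟨m, hm⟩ := padicValInt_dvd (p := p) n
      have hdvd : ¬ (p : ℤ) ∣ m := by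
        rintro ⟨k, rfl⟩
        have := (padicValInt_dvd_iff (p := p) (padicValInt p n + 1) n).1
          ⟨k, by rw [pow_succ, mul_assoc]; exact hm⟩
        omega
      conv_lhs => rw [hm, h.mul, h.pow, h.eq_one_of_not_dvd hp hlt hdvd, mul_one]
  · left
    push Not at hex
    have hone : ∀ n : ℕ, n ≠ 0 → 1 ≤ N n := by
      intro n
      induction n using Nat.recOnMul with
      | zero => simp
      | one => simp [h.one]
      | prime p hp => exact fun _ => hex p hp
      | mul a b iha ihb =>
        intro hab
        push_cast
        rw [h.mul]
        exact one_le_mul_of_one_le_of_one_le (iha (left_ne_zero_of_mul hab))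
          (ihb (right_ne_zero_of_mul hab))
    -- The inequality is symmetric in b and n, so the ratio log N(n) / log n is constant; its value,
    -- read off at 2, is the exponent t.
    have hle : ∀ b n : ℕ, 2 ≤ b → 2 ≤ n →
        Real.log (N n) / Real.log n ≤ Real.log (N b) / Real.log b := by
      intro b n hb hn
      have hNb := hone b (by omega)
      have hlb : 0 < Real.log b := Real.log_pos (by exact_mod_cast hb)
      have hln : 0 < Real.log n := Real.log_pos (by exact_mod_cast hn)
      have h1 := Real.log_le_log (by linarith [hone n (by omega)])
        (h.natCast_le_rpow_logb hb (by omega : 1 ≤ n) hNb le_rfl)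
      rw [Real.log_rpow (by linarith), Real.logb] at h1
      rw [div_le_iff₀ hln]
      refine h1.trans_eq ?_
      field_simp
    set t := Real.log (N (2 : ℕ)) / Real.log (2 : ℕ) with ht
    have hl2 : 0 < Real.log (2 : ℕ) := Real.log_pos (by norm_num)
    have h2 := hone 2 (by norm_num)
    refine ⟨t, div_nonneg (Real.log_nonneg h2) hl2.le, ?_, funext fun n => ?_⟩
    · rw [ht, div_le_one hl2]
      exact Real.log_le_log (by linarith) (h.natCast_le 2)
    · unfold archAbs
      split_ifs with hn
      · rw [hn, h.zero]
      rw [← h.natAbs]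
      have hn' : n.natAbs ≠ 0 := Int.natAbs_ne_zero.2 hn
      generalize n.natAbs = m at hn'
      rcases Nat.lt_or_ge m 2 with hm | hm
      · obtain rfl : m = 1 := by omega
        simp [h.one]
      · have hlm : 0 < Real.log m := Real.log_pos (by exact_mod_cast hm)
        have hNm := hone m hn'
        have := (hle 2 m le_rfl hm).antisymm (hle m 2 hm le_rfl)
        rw [← ht, div_eq_iff hlm.ne'] at this
        rw [Real.rpow_def_of_pos (by positivity), mul_comm, ← this, Real.exp_log (by linarith)]

/-! ### Compatible pairs at a point -/

/-- A nonzero prime ideal contains a prime p and then equals pℤ, and compatibility makes λ negative.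
For the zero ideal it makes λ non-negative, hence a real number in [0, 1]. -/
theorem IsCompatiblePair.cases {P : ℤ → Prop} {l : Cut Prop} (h : IsCompatiblePair P l) :
    (∃ t, 0 ≤ t ∧ t ≤ 1 ∧ (∀ a, P a ↔ a = 0) ∧ l.Represents t) ∨
      ∃ p : ℕ, p.Prime ∧ ∃ c : ℝ, 0 ≤ c ∧ c < 1 ∧ (∀ a, P a ↔ (p : ℤ) ∣ a) ∧
        ∀ q : ℚ, l q ↔ c < (p : ℝ) ^ (q : ℝ) := by
  have hP0 : P 0 := h.prime _ _ .zero trivial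
  have hP1 : ¬ P 1 := h.prime _ _ .one
  have hadd : ∀ a b, P a → P b → P (a + b) := fun a b ha hb => h.prime _ _ (.add a b) ⟨ha, hb⟩
  have hmul : ∀ a b, P a ∨ P b → P (a * b) := fun a b => h.prime _ _ (.mul a b)
  have hprime : ∀ a b, P (a * b) → P a ∨ P b := fun a b => h.prime _ _ (.prime a b)
  have hu : ∀ a b, Cut.UpperReal l a b → a ≤ b := fun a b hab => h.exponent a b (.real hab)
  have hl1 : ∀ q : ℚ, 1 < q → l q := fun q hq =>
    h.exponent _ _ (.le_one (.mk q)) (by simpa [Cut.const] using hq)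
  have hcompat : l 0 ↔ ∃ a, a ≠ 0 ∧ P a := by
    rw [h.compat]
    simp [iSup_Prop_eq]
  by_cases hex : ∃ a, a ≠ 0 ∧ P a
  · right
    have hpn : ∀ n : ℕ, n ≠ 0 → P n → ∃ p : ℕ, p.Prime ∧ P p := by
      intro n
      induction n using Nat.recOnMul with
      | zero => simp
      | one => exact fun _ h1 => absurd (by simpa using h1) hP1
      | prime p hp => exact fun _ hPp => ⟨p, hp, hPp⟩
      | mul a b iha ihb =>
        intro hab hPab
        push_cast at hPab
        exact (hprime _ _ hPab).elim (iha (left_ne_zero_of_mul hab))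
          (ihb (right_ne_zero_of_mul hab))
    obtain ⟨p, hp, hPp⟩ : ∃ p : ℕ, p.Prime ∧ P p := by
      obtain ⟨a, ha, hPa⟩ := hex
      refine hpn a.natAbs (Int.natAbs_ne_zero.2 ha) ?_
      rw [← Int.sign_mul_self_eq_natAbs]
      exact hmul _ _ (.inr hPa)
    have hp1 : (1 : ℝ) < p := by exact_mod_cast hp.one_lt
    -- λ may be -∞, so the infimum is taken of the p^q, which are bounded below by 0; it plays the
    -- role of p^λ.
    have he : StrictMono fun q : ℚ => (p : ℝ) ^ (q : ℝ) := fun q r hqr =>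
      Real.rpow_lt_rpow_of_exponent_lt hp1 (by exact_mod_cast hqr)
    have h0 : ∀ y ∈ (fun q : ℚ => (p : ℝ) ^ (q : ℝ)) '' {q | l q}, 0 ≤ y := by
      rintro _ ⟨q, -, rfl⟩
      positivity
    have hc := Cut.iff_sInf_lt hu he ⟨2, hl1 2 (by norm_num)⟩ ⟨0, h0⟩
    refine ⟨p, hp, _, Real.sInf_nonneg h0, by simpa using (hc 0).1 (hcompat.2 hex), fun a => ?_, hc⟩
    constructor
    · intro ha
      by_contra hdvd
      -- By Bézout, an element of the ideal prime to p would put 1 in the ideal.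
      obtain ⟨x, y, hxy⟩ := (Prime.coprime_iff_not_dvd (Nat.prime_iff_prime_int.1 hp)).2 hdvd
      exact hP1 (hxy ▸ hadd _ _ (hmul _ _ (.inr hPp)) (hmul _ _ (.inr ha)))
    · rintro ⟨k, rfl⟩
      exact hmul _ _ (.inl hPp)
  · left
    have hl0 : ¬ l 0 := fun h0 => hex (hcompat.1 h0)
    have h0 : ∀ y ∈ (fun q : ℚ => (q : ℝ)) '' {q | l q}, 0 ≤ y := by
      rintro _ ⟨q, hq, rfl⟩
      by_contra! hneg
      exact hl0 (hu _ _ (.up q 0 (by exact_mod_cast hneg.le)) hq)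
    have ht := Cut.iff_sInf_lt hu Rat.cast_strictMono ⟨2, hl1 2 (by norm_num)⟩ ⟨0, h0⟩
    refine ⟨_, Real.sInf_nonneg h0, ?_, fun a => ⟨fun ha => ?_, fun ha => ha ▸ hP0⟩, ht⟩
    · have h1 := (Cut.Represents.le_iff ht (Cut.represents_const 1)).1
        fun a b hab => h.exponent a b (.le_one hab)
      simpa using h1
    · by_contra ha0
      exact hex ⟨a, ha0, ha⟩

theorem isCompatiblePair_arch {P : ℤ → Prop} {l : Cut Prop} {t : ℝ} (h0 : 0 ≤ t) (h1 : t ≤ 1)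
    (hP : ∀ a, P a ↔ a = 0) (hl : l.Represents t) : IsCompatiblePair P l where
  prime := by
    rintro _ _ (_ | ⟨a, b⟩ | ⟨a, b⟩ | _ | ⟨a, b⟩) <;>
      simp +contextual [hP]
  exponent := by
    rintro a b (hab | hab)
    · exact hl.upperReal a b hab
    · exact (hl.le_iff (Cut.represents_const 1)).2 (by simpa using h1) a b hab
  compat := by
    simp [iSup_Prop_eq, hP, hl _, h0]

theorem isCompatiblePair_padic {P : ℤ → Prop} {l : Cut Prop} {p : ℕ} (hp : p.Prime) {c : ℝ}
    (h1 : c < 1) (hP : ∀ a, P a ↔ (p : ℤ) ∣ a)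
    (hl : ∀ q : ℚ, l q ↔ c < (p : ℝ) ^ (q : ℝ)) : IsCompatiblePair P l where
  prime := by
    have hpz := Nat.prime_iff_prime_int.1 hp
    rintro _ _ (_ | ⟨a, b⟩ | ⟨a, b⟩ | _ | ⟨a, b⟩)
    · simp [hP]
    · simpa [hP] using fun h => dvd_add h
    · simpa [hP] using Or.rec (fun h => h.mul_right b) fun h => h.mul_left a
    · simpa [hP] using hpz.not_dvd_one
    · simpa [hP] using hpz.dvd_or_dvd
  exponent := by
    have hp1 : (1 : ℝ) < p := by exact_mod_cast hp.one_lt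
    rintro _ _ ((⟨q, r, hqr⟩ | ⟨q⟩) | ⟨⟨q⟩⟩) h
    · rw [hl] at h ⊢
      exact h.trans_le (Real.rpow_le_rpow_of_exponent_le hp1.le (by exact_mod_cast hqr))
    · rw [hl] at h
      simp only [iSup_Prop_eq, exists_prop, hl]
      have hc : ContinuousAt (fun t : ℝ => (p : ℝ) ^ t) q :=
        Real.continuousAt_const_rpow (zero_lt_one.trans hp1).ne'
      obtain ⟨ε, hε, h'⟩ := Metric.eventually_nhds_iff.1 (hc.eventually_const_lt h)
      obtain ⟨r, hr1, hr2⟩ := exists_rat_btwn (sub_lt_self (q : ℝ) hε)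
      exact ⟨r, by exact_mod_cast hr2,
        h' (by rw [Real.dist_eq, abs_lt]; constructor <;> linarith)⟩
    · rw [Cut.represents_const] at h
      rw [hl]
      refine h1.trans (Real.one_lt_rpow hp1 ?_)
      push_cast at h
      linarith
  compat := by
    have : ∃ a : ℤ, a ≠ 0 ∧ (p : ℤ) ∣ a := ⟨p, by exact_mod_cast hp.ne_zero, dvd_rfl⟩
    simpa [iSup_Prop_eq, hP, hl, h1] using this

/-! ### The two constructions at a point -/

theorem exponentOf_iff (v : ℤ → Cut Prop) (q : ℚ) : exponentOf v q ↔
    ∃ p : Nat.Primes, ∃ r : ℚ, (r : ℝ) < ((p : ℕ) : ℝ) ^ (q : ℝ) ∧ v (p : ℕ) r := by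
  simp [exponentOf, Cut.infOver, Cut.log, iSup_Prop_eq]

/-- Logarithms are avoided by comparing with p^q, so N p = 0 needs no separate treatment. -/
theorem exponentOf_iff_of_represents {v : ℤ → Cut Prop} {N : ℤ → ℝ}
    (hv : ∀ n, (v n).Represents (N n)) (q : ℚ) : exponentOf v q ↔
    ∃ p : ℕ, p.Prime ∧ N p < (p : ℝ) ^ (q : ℝ) := by
  rw [exponentOf_iff]
  constructor
  · rintro ⟨p, r, h1, h2⟩
    exact ⟨p, p.2, ((hv _ _).1 h2).trans h1⟩
  · rintro ⟨p, hp, h⟩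
    obtain ⟨r, h1, h2⟩ := exists_rat_btwn h
    exact ⟨⟨p, hp⟩, r, h2, (hv _ _).2 h1⟩

theorem idealOf_iff_of_represents {v : ℤ → Cut Prop} {N : ℤ → ℝ}
    (hv : ∀ n, (v n).Represents (N n)) (n : ℤ) : idealOf v n ↔ N n < 1 := by
  refine (hv n 1).trans ?_
  rw [Rat.cast_one]

theorem idealOf_arch {v : ℤ → Cut Prop} {t : ℝ} (h0 : 0 ≤ t)
    (hv : ∀ n, (v n).Represents (archAbs t n)) (n : ℤ) : idealOf v n ↔ n = 0 := by
  rw [idealOf_iff_of_represents hv]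
  unfold archAbs
  split_ifs with hn
  · simp [hn]
  · have : (1 : ℝ) ≤ n.natAbs := by exact_mod_cast Int.natAbs_pos.2 hn
    simp only [hn, iff_false, not_lt]
    exact Real.one_le_rpow this h0

theorem exponentOf_arch {v : ℤ → Cut Prop} {t : ℝ}
    (hv : ∀ n, (v n).Represents (archAbs t n)) : (exponentOf v).Represents t := by
  have key : ∀ p : ℕ, p.Prime → ∀ q : ℚ, archAbs t p < (p : ℝ) ^ (q : ℝ) ↔ t < q := by
    intro p hp q
    have hp1 : (1 : ℝ) < p := by exact_mod_cast hp.one_lt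
    simp [archAbs, hp.ne_zero, Real.rpow_lt_rpow_left_iff hp1]
  intro q
  rw [exponentOf_iff_of_represents hv]
  -- Every prime contributes the same logarithm t, so any prime can serve as witness.
  exact ⟨fun ⟨p, hp, h⟩ => (key p hp q).1 h, fun h => ⟨2, Nat.prime_two, (key 2 Nat.prime_two q).2 h⟩⟩

theorem idealOf_padic {v : ℤ → Cut Prop} {p : ℕ} (hp : p.Prime) {c : ℝ} (h0 : 0 ≤ c) (h1 : c < 1)
    (hv : ∀ n, (v n).Represents (padicAbs p c n)) (n : ℤ) : idealOf v n ↔ (p : ℤ) ∣ n := by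
  rw [idealOf_iff_of_represents hv]
  unfold padicAbs
  split_ifs with hn
  · simp [hn]
  · by_cases hd : (p : ℤ) ∣ n
    · have : padicValInt p n ≠ 0 := fun h => by
        rcases padicValInt.eq_zero_iff.1 h with h | h | h
        · exact hp.ne_one h
        · exact hn h
        · exact h hd
      simp only [hd, iff_true]
      exact pow_lt_one₀ h0 h1 this
    · simp [hd, padicValInt.eq_zero_of_not_dvd hd]

theorem exponentOf_padic {v : ℤ → Cut Prop} {p : ℕ} (hp : p.Prime) {c : ℝ} (h1 : c < 1)
    (hv : ∀ n, (v n).Represents (padicAbs p c n)) (q : ℚ) :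
    exponentOf v q ↔ c < (p : ℝ) ^ (q : ℝ) := by
  have hself : padicAbs p c p = c := by
    simp [padicAbs, hp.ne_zero, padicValInt.self hp.one_lt]
  rw [exponentOf_iff_of_represents hv]
  constructor
  · rintro ⟨p', hp', h⟩
    rcases eq_or_ne p' p with rfl | hne
    · rwa [hself] at h
    -- Another prime has absolute value 1 and logarithm 0, so it contributes only q > 0, where c < 1
    -- < p^q already holds.
    · have hnd : ¬ (p : ℤ) ∣ p' := by
        rw [Int.natCast_dvd_natCast, Nat.prime_dvd_prime_iff_eq hp hp']
        exact hne.symm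
      have hN : padicAbs p c p' = 1 := by
        simp [padicAbs, hp'.ne_zero, padicValInt.eq_zero_of_not_dvd hnd]
      rw [hN] at h
      have hq : (0 : ℝ) < q := by
        by_contra! hq
        exact h.not_ge (Real.rpow_le_one_of_one_le_of_nonpos (by exact_mod_cast hp'.one_le) hq)
      exact h1.trans (Real.one_lt_rpow (by exact_mod_cast hp.one_lt) hq)
  · intro h
    exact ⟨p, hp, by rwa [hself]⟩

theorem absOf_zero {A : Type*} [Order.Frame A] (P : ℤ → A) (l : Cut A) :
    absOf P l 0 = Cut.const 0 := if_pos rfl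

/-- The zero ideal contains no prime, so the infimum is empty and the first factor is 1; as t ≥ 0,
the second factor is |n|^t. -/
theorem represents_absOf_arch {P : ℤ → Prop} {l : Cut Prop} {t : ℝ} (h0 : 0 ≤ t)
    (hP : ∀ a, P a ↔ a = 0) (hl : l.Represents t) (n : ℤ) :
    (absOf P l n).Represents (archAbs t n) := by
  rcases eq_or_ne n 0 with rfl | hn
  · rw [absOf_zero]
    simpa [archAbs] using Cut.represents_const 0
  have hn1 : (1 : ℝ) ≤ n.natAbs := by exact_mod_cast Int.natAbs_pos.2 hn
  have hN : 1 ≤ (n.natAbs : ℝ) ^ t := Real.one_le_rpow hn1 h0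
  rw [absOf, if_neg hn, archAbs, if_neg hn, ← one_mul ((n.natAbs : ℝ) ^ t)]
  refine Cut.Represents.mul (fun q => ?_) (fun q => ?_) zero_le_one (zero_le_one.trans hN)
  · have hno : ∀ p : Nat.Primes, ¬ P (p : ℕ) := fun p => by
      rw [hP]
      exact_mod_cast p.2.ne_zero
    simp only [Cut.min, Cut.infOver, hno, sup_Prop_eq, inf_Prop_eq, iSup_Prop_eq, false_and,
      exists_false, or_false]
    simpa using Cut.represents_const 1 q
  · have := (Cut.represents_const 1).max (hl.exp hn1) q
    rwa [Rat.cast_one, sup_eq_right.2 hN] at this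

theorem exists_rat_rpow_btwn {b x y : ℝ} (hb : 1 < b) (hx : 0 ≤ x) (hxy : x < y) :
    ∃ r : ℚ, x < b ^ (r : ℝ) ∧ b ^ (r : ℝ) < y := by
  have hy : 0 < y := hx.trans_lt hxy
  -- The midpoint replaces x, which may be 0 and then has no logarithm.
  have hm : 0 < (x + y) / 2 := by linarith
  obtain ⟨r, h1, h2⟩ := exists_rat_btwn
    (Real.logb_lt_logb hb hm (by linarith : (x + y) / 2 < y))
  refine ⟨r, ?_, (Real.lt_logb_iff_rpow_lt hb hy).1 h2⟩
  have := (Real.logb_lt_iff_lt_rpow hb hm).1 h1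
  linarith

/-- The only prime in pℤ is p, so the first factor is (p^λ)^ord_p(n), that is, a power of c; as λ <
0, the second factor is 1. -/
theorem represents_absOf_padic {P : ℤ → Prop} {l : Cut Prop} {p : ℕ} (hp : p.Prime) {c : ℝ}
    (h0 : 0 ≤ c) (h1 : c < 1) (hP : ∀ a, P a ↔ (p : ℤ) ∣ a)
    (hl : ∀ q : ℚ, l q ↔ c < (p : ℝ) ^ (q : ℝ)) (n : ℤ) :
    (absOf P l n).Represents (padicAbs p c n) := by
  rcases eq_or_ne n 0 with rfl | hn
  · rw [absOf_zero]
    simpa [padicAbs] using Cut.represents_const 0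
  have hp1 : (1 : ℝ) < p := by exact_mod_cast hp.one_lt
  have hle : c ^ padicValInt p n ≤ 1 := pow_le_one₀ h0 h1.le
  rw [absOf, if_neg hn, padicAbs, if_neg hn, ← mul_one (c ^ padicValInt p n)]
  refine Cut.Represents.mul (fun q => ?_) (fun q => ?_) (pow_nonneg h0 _) zero_le_one
  · simp only [Cut.min, Cut.infOver, Cut.exp, sup_Prop_eq, inf_Prop_eq, iSup_Prop_eq, hP, hl,
      Cut.represents_const 1 q, Rat.cast_one, exists_prop]
    have hpow : ∀ r : ℚ, ((p ^ padicValInt p n : ℕ) : ℝ) ^ (r : ℝ) =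
        ((p : ℝ) ^ (r : ℝ)) ^ padicValInt p n := fun r => by
      rw [Nat.cast_pow, ← Real.rpow_natCast, ← Real.rpow_natCast, ← Real.rpow_mul (by positivity),
        ← Real.rpow_mul (by positivity), mul_comm]
    constructor
    · rintro (h | ⟨p', hdvd, r, h2, h3⟩)
      · exact hle.trans_lt h
      · obtain rfl : p = p' :=
          (Nat.prime_dvd_prime_iff_eq hp p'.2).1 (by exact_mod_cast hdvd)
        rw [hpow] at h2
        exact (pow_le_pow_left₀ h0 h3.le _).trans_lt h2
    · intro h
      refine .inr ⟨⟨p, hp⟩, dvd_rfl, ?_⟩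
      have hc : ContinuousAt (fun t : ℝ => t ^ padicValInt p n) c := (continuous_pow _).continuousAt
      obtain ⟨ε, hε, h'⟩ := Metric.eventually_nhds_iff.1 (hc.eventually_lt_const h)
      obtain ⟨r, h2, h3⟩ := exists_rat_rpow_btwn hp1 h0 (lt_add_of_pos_right c hε)
      refine ⟨r, ?_, h2⟩
      rw [hpow]
      exact h' (by rw [Real.dist_eq, abs_lt]; constructor <;> linarith)
  · simp only [Cut.max, Cut.exp, inf_Prop_eq, iSup_Prop_eq, hl, Cut.represents_const 1 q,
      Rat.cast_one, exists_prop]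
    -- The exponent r = 0 is admissible because λ < 0, and it gives N^0 = 1 < q.
    exact ⟨fun h => h.1, fun h => ⟨h, 0, by simpa using h, by simpa using h1⟩⟩

/-- The correspondence at a point, from absolute values to pairs. -/
theorem IsAbsoluteValue.pair_of_point {v : ℤ → Cut Prop} (hv : IsAbsoluteValue v) :
    IsCompatiblePair (idealOf v) (exponentOf v) ∧ absOf (idealOf v) (exponentOf v) = v := by
  obtain ⟨N, hN, hvN⟩ := isAbsoluteValue_iff_exists.1 hv
  rcases hN.eq_archAbs_or_eq_padicAbs with ⟨t, h0, h1, rfl⟩ | ⟨p, hp, c, h0, h1, rfl⟩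
  · have hi := idealOf_arch h0 hvN
    have he := exponentOf_arch hvN
    exact ⟨isCompatiblePair_arch h0 h1 hi he,
      funext fun n => (represents_absOf_arch h0 hi he n).eq (hvN n)⟩
  · have hi := idealOf_padic hp h0 h1 hvN
    have he := exponentOf_padic hp h1 hvN
    exact ⟨isCompatiblePair_padic hp h1 hi he,
      funext fun n => (represents_absOf_padic hp h0 h1 hi he n).eq (hvN n)⟩

/-- The correspondence at a point, from pairs to absolute values. -/
theorem IsCompatiblePair.abs_of_point {P : ℤ → Prop} {l : Cut Prop} (h : IsCompatiblePair P l) :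
    IsAbsoluteValue (absOf P l) ∧ idealOf (absOf P l) = P ∧ exponentOf (absOf P l) = l := by
  rcases h.cases with ⟨t, h0, h1, hP, hl⟩ | ⟨p, hp, c, h0, h1, hP, hl⟩
  · have ha := represents_absOf_arch h0 hP hl
    exact ⟨isAbsoluteValue_iff_exists.2 ⟨_, isRealAbs_archAbs h0 h1, ha⟩,
      funext fun a => propext ((idealOf_arch h0 ha a).trans (hP a).symm),
      (exponentOf_arch ha).eq hl⟩
  · have ha := represents_absOf_padic hp h0 h1 hP hl
    exact ⟨isAbsoluteValue_iff_exists.2 ⟨_, isRealAbs_padicAbs hp h0 h1.le, ha⟩,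
      funext fun a => propext ((idealOf_padic hp h0 h1 ha a).trans (hP a).symm),
      funext fun q => propext ((exponentOf_padic hp h1 ha q).trans (hl q).symm)⟩

/-! ### The correspondence for the generic points -/

theorem AV_eq_of_forall_point {a b : (AV ℤ).Opens}
    (h : ∀ p : FrameHom (AV ℤ).Opens Prop, p a = p b) : a = b :=
  le_antisymm (AV_le_of_forall_point fun p => (h p).le) (AV_le_of_forall_point fun p => (h p).ge)

theorem compatiblePairs_eq_of_forall_point {a b : compatiblePairs}
    (h : ∀ p : FrameHom compatiblePairs Prop, p a = p b) : a = b :=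
  le_antisymm (compatiblePairs_le_of_forall_point fun p => (h p).le)
    (compatiblePairs_le_of_forall_point fun p => (h p).ge)

/-- Every point of the space makes the generic absolute value an actual one, for which the sequents
are known; having enough points lifts them to the frame. -/
theorem isCompatiblePair_genericAV :
    IsCompatiblePair (idealOf (genericAV ℤ)) (exponentOf (genericAV ℤ)) := by
  have hp := fun p : FrameHom (AV ℤ).Opens Prop => (isAbsoluteValue_comp p).pair_of_point.1
  have he := fun p : FrameHom (AV ℤ).Opens Prop => funext (map_exponentOf p (genericAV ℤ))
  refine ⟨fun a b hab => AV_le_of_forall_point fun p => ?_,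
    fun a b hab => AV_le_of_forall_point fun p => ?_, AV_eq_of_forall_point fun p => ?_⟩
  · refine (hp p).prime _ _ ?_
    change PrimeIdealSeq (fun n => p (idealOf (genericAV ℤ) n)) _ _
    rw [primeIdealSeq_map]
    exact ⟨a, b, hab, rfl, rfl⟩
  · refine (hp p).exponent _ _ ?_
    rw [← he p, leOneSeq_map]
    exact ⟨a, b, hab, rfl, rfl⟩
  · rw [map_exponentOf, (hp p).compat]
    simp only [map_iSup]
    rfl

theorem absOf_genericAV : absOf (idealOf (genericAV ℤ)) (exponentOf (genericAV ℤ)) =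
    genericAV ℤ := by
  refine funext₂ fun n q => AV_eq_of_forall_point fun p => ?_
  have h := congrFun₂ (isAbsoluteValue_comp p).pair_of_point.2 n q
  rw [map_absOf]
  rw [← funext (map_exponentOf p (genericAV ℤ))] at h
  exact h

theorem isAbsoluteValue_generic : IsAbsoluteValue (absOf genericMem genericExponent) := by
  intro a b hab
  refine compatiblePairs_le_of_forall_point fun p => ?_
  refine (isCompatiblePair_comp p).abs_of_point.1 _ _ ?_
  rw [← funext₂ (map_absOf p genericMem genericExponent), absoluteValueSeq_map]
  exact ⟨a, b, hab, rfl, rfl⟩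

theorem idealOf_generic : idealOf (absOf genericMem genericExponent) = genericMem := by
  refine funext fun a => compatiblePairs_eq_of_forall_point fun p => ?_
  have h := congrFun (isCompatiblePair_comp p).abs_of_point.2.1 a
  rw [← funext₂ (map_absOf p genericMem genericExponent)] at h
  exact h

theorem exponentOf_generic : exponentOf (absOf genericMem genericExponent) = genericExponent := by
  refine funext fun q => compatiblePairs_eq_of_forall_point fun p => ?_
  have h := congrFun (isCompatiblePair_comp p).abs_of_point.2.2 q
  rw [map_exponentOf]
  rw [← funext₂ (map_absOf p genericMem genericExponent)] at h
  exact h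

end PointFree

/-! ### The isomorphism of locales -/

theorem theorem4p1 :
    ∃ φ : (PointFree.AV ℤ).space ≅ PointFree.PLambda,
      (∀ a : ℤ, PointFree.preimage φ.hom (PointFree.genericMem a) =
        PointFree.idealOf (PointFree.genericAV ℤ) a) ∧
      (∀ q : ℚ, PointFree.preimage φ.hom (PointFree.genericExponent q) =
        PointFree.exponentOf (PointFree.genericAV ℤ) q) ∧
      (∀ (n : ℤ) (q : ℚ), PointFree.preimage φ.inv (PointFree.genericAV ℤ n q) =
        PointFree.absOf PointFree.genericMem PointFree.genericExponent n q) := by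
  obtain ⟨f, ⟨hfm, hfe⟩, -⟩ :=
    PointFree.existsUnique_frameHom_compatiblePairs PointFree.isCompatiblePair_genericAV
  obtain ⟨g, hg, -⟩ := PointFree.existsUnique_frameHom_AV PointFree.isAbsoluteValue_generic
  -- A frame homomorphism is determined by its values on the generic model, so the composite need
  -- only be compared with the identity there.
  have hfg : f.comp g = FrameHom.id _ := by
    obtain ⟨_, -, hu⟩ := PointFree.existsUnique_frameHom_AV
      (PointFree.isAbsoluteValue_comp (FrameHom.id (PointFree.AV ℤ).Opens))
    refine (hu (f.comp g) fun n q => ?_).trans (hu _ fun n q => rfl).symm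
    change f (g (PointFree.genericAV ℤ n q)) = PointFree.genericAV ℤ n q
    rw [hg, PointFree.map_absOf, funext hfm, funext hfe]
    exact congrFun₂ PointFree.absOf_genericAV n q
  have hgf : g.comp f = FrameHom.id _ := by
    obtain ⟨_, -, hu⟩ := PointFree.existsUnique_frameHom_compatiblePairs
      (PointFree.isCompatiblePair_comp (FrameHom.id PointFree.compatiblePairs))
    refine (hu (g.comp f) ⟨fun a => ?_, fun q => ?_⟩).trans
      (hu _ ⟨fun a => rfl, fun q => rfl⟩).symm
    · change g (f (PointFree.genericMem a)) = PointFree.genericMem a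
      rw [hfm]
      -- Membership in the ideal is by definition the open |a| < 1.
      exact (hg a 1).trans (congrFun PointFree.idealOf_generic a)
    · change g (f (PointFree.genericExponent q)) = PointFree.genericExponent q
      rw [hfe, PointFree.map_exponentOf, funext₂ hg]
      exact congrFun PointFree.exponentOf_generic q
  -- Locale maps run opposite to frame homomorphisms, so `f`, defined on the opens of the space of
  -- pairs, is the forward map.
  exact ⟨⟨(Frm.ofHom f).op, (Frm.ofHom g).op,
    Quiver.Hom.unop_inj (Frm.hom_ext hfg), Quiver.Hom.unop_inj (Frm.hom_ext hgf)⟩, hfm, hfe, hg⟩
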